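/- Let $n\ge 2$ and $0\le k\le m$ be integers. Tensors on $\mathbb R^n$ are complex and are written through their components in the standard orthonormal basis, with summation over repeated indices; $S^m$ is the space of symmetric tensors of rank $m$, and $\mathcal S(\mathbb R^n;S^m)$ is the space of symmetric rank $m$ tensor fields whose components are Schwartz functions. **Notation.** - For a tensor $v$ of rank $r+q$ and a tensor $u$ of rank $q$, the contraction $v/u=j_uv$ is $(v/u)_{i_1\dots i_r}=v_{i_1\dots i_r j_1\dots j_q}u^{j_1\dots j_q}$. In particular, $j_y$ is the contraction with the vector $y\in\mathbb R^n$. - The inner derivative of a symmetric tensor field $u$ of rank $p$ is the symmetric field of rank $p+1$ given by $(du)_{i_1\dots i_{p+1}}=\sigma\,\partial u_{i_1\dots i_p}/\partial x^{i_{p+1}}$, where $\sigma$ is the symmetrization in $i_1,\dots,i_{p+1}$. - The Fourier transform is $\widehat f(y)=(2\pi)^{-n/2}\int_{\mathbb R^n}e^{-\mathrm i\langle y,x\rangle}f(x)\,dx$, applied componentwise to tensor fields and extended to tempered distributions by duality. - $T\mathbb S^{n-1}=\{(x,\xi)\in\mathbb R^n\times\mathbb R^n:\ |\xi|=1,\ \langle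 x,\xi\rangle=0\}$. For $f\in\mathcal S(\mathbb R^n;S^m)$, the momentum ray transform of $f$ is the function on $T\mathbb S^{n-1}$ $$I_m^kf(x,\xi)=\int_{\mathbb R}t^k f_{i_1\dots i_m}(x+t\xi)\,\xi^{i_1}\cdots\xi^{i_m}\,dt .$$ Its formal $L^2$-adjoint is $$\big((I_m^k)^*\varphi\big)_{i_1\dots i_m}(x)=\int_{\mathbb S^{n-1}}\langle x,\xi\rangle^k\,\xi_{i_1}\cdots\xi_{i_m}\,\varphi\big(x-\langle x,\xi\rangle\xi,\xi\big)\,d\xi ,$$ where $d\xi$ is the surface measure of the unit sphere, and $N_m^k=(I_m^k)^*I_m^k$ is the normal operator. - For $y\in\mathbb R^n\setminus\{0\}$, $A^{(m,k)}(y)=d^{2m-k}|y|^{2m-2k-1}$, a symmetric tensor of rank $2m-k$. **Proposition.** Let $f\in\mathcal S(\mathbb R^n;S^m)$. Then $N_m^kf$ defines a tempered tensor field-distribution, the restriction of its Fourier transform $\widehat{N_m^kf}$ to $\mathbb R^n\setminus\{0\}$ belongs to $C^\infty(\mathbb R^n\setminus\{0\};S^m)$, and, with $$F^{(m,k)}(y)=\frac{2^{m-2}\,(2m-1)!!\,\Gamma\big(\frac{2m+n-1}{2}\big)}{\pi^{(n+1)/2}\,k!}\;j_y^k\,\widehat{N_m^kf}(y)\qquad(y\ne0)$$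 (where $(-1)!!=1$), the following equality holds: $$\big(A^{(m,0)}/(d^k\widehat f\,)\big)(y)=F^{(m,k)}(y)\qquad\text{for all }y\in\mathbb R^n\setminus\{0\}.$$ -/

import Mathlib

open scoped SchwartzMap FourierTransform ContDiff

noncomputable section

namespace MomentumRay

/-- The Euclidean space `ℝⁿ`. -/
abbrev Euc (n : ℕ) : Type := EuclideanSpace ℝ (Fin n)

/-- The complex vector space `T^m ℝⁿ` of rank `m` tensors on `ℝⁿ`: a tensor is the family
of its components `u_{i₁…i_m}` in the standard orthonormal basis. -/
abbrev Tensor (n m : ℕ) : Type := (Fin m → Fin n) → ℂ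

variable {n m : ℕ}

/-! ### Tensor algebra -/

/-- The components are symmetric in all indices. It is stated for families with values in any
type, so that it applies to tensors, to Schwartz tensor fields and to tensor distributions. -/
def IsSymm {α : Type} (u : (Fin m → Fin n) → α) : Prop :=
  ∀ (π : Equiv.Perm (Fin m)) (i : Fin m → Fin n), u (i ∘ π) = u i

/-- The symmetrization `σ : T^m → S^m` in all indices. -/
def symmetrize (u : Tensor n m) : Tensor n m :=
  fun i => ((m.factorial : ℂ))⁻¹ * ∑ π : Equiv.Perm (Fin m), u (i ∘ π)

/-- The contraction `v / u = j_u v`,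
`(v / u)_{i₁…i_r} = v_{i₁…i_r j₁…j_q} u^{j₁…j_q}`, for `v` of rank `p = r + q`. -/
def contract {p q r : ℕ} (h : r + q = p) (v : Tensor n p) (u : Tensor n q) : Tensor n r :=
  fun i => ∑ j : Fin q → Fin n, v (Fin.append i j ∘ Fin.cast h.symm) * u j

/-- The contraction `j_y` with a vector `y ∈ ℝⁿ` regarded as a tensor of rank one. -/
def contractVec {r : ℕ} (y : Euc n) (v : Tensor n (r + 1)) : Tensor n r :=
  contract rfl v (fun j : Fin 1 → Fin n => ((y (j 0) : ℝ) : ℂ))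

/-- The `k`-th power `j_y^k`. -/
def contractVecPow {r : ℕ} (y : Euc n) : (k : ℕ) → Tensor n (r + k) → Tensor n r
  | 0, v => v
  | k + 1, v => contractVecPow y k (contractVec (r := r + k) y v)

/-- The identification of tensors of ranks `p` and `q` when `p = q`. -/
def castRank {p q : ℕ} (h : p = q) (v : Tensor n p) : Tensor n q :=
  fun i => v (i ∘ Fin.cast h)

/-! ### The inner derivative -/

/-- The partial derivative `∂u/∂x^j`. -/
def partialDeriv (j : Fin n) (u : Euc n → ℂ) (x : Euc n) : ℂ :=
  fderiv ℝ u x (EuclideanSpace.single j (1 : ℝ))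

/-- The inner derivative `(d u)_{i₁…i_{m+1}} = σ(i₁…i_{m+1}) ∂u_{i₁…i_m}/∂x^{i_{m+1}}`. -/
def innerDeriv (u : Euc n → Tensor n m) : Euc n → Tensor n (m + 1) :=
  fun x => symmetrize fun i : Fin (m + 1) → Fin n =>
    partialDeriv (i (Fin.last m)) (fun z => u z (Fin.init i)) x

/-- The `k`-th power `d^k` of the inner derivative. -/
def innerDerivPow : (k : ℕ) → (Euc n → Tensor n m) → Euc n → Tensor n (m + k)
  | 0, u => u
  | k + 1, u => innerDeriv (innerDerivPow k u)

/-- The tensor field `A^{(m,k)}(y) = d^{2m-k} |y|^{2m-2k-1}` of rank `2m - k`. -/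
def tensorA (n m k : ℕ) (y : Euc n) : Tensor n (2 * m - k) :=
  castRank (zero_add _) (innerDerivPow (m := 0) (2 * m - k)
    (fun z _ => ((‖z‖ ^ (2 * (m : ℤ) - 2 * (k : ℤ) - 1) : ℝ) : ℂ)) y)

/-! ### The Fourier transform -/

/-- The linear dilation `y ↦ y / (2π)`. -/
def dilation (n : ℕ) : Euc n ≃L[ℝ] Euc n :=
  ContinuousLinearEquiv.smulLeft
    (Units.mk0 ((2 * Real.pi)⁻¹ : ℝ) (inv_ne_zero Real.two_pi_pos.ne'))

/-- The Fourier transform on the Schwartz space normalized as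
`φ̂(y) = (2π)^{-n/2} ∫ e^{-i⟨y,x⟩} φ(x) dx` (see `fourier_apply`). -/
def fourier (n : ℕ) : 𝓢(Euc n, ℂ) →L[ℂ] 𝓢(Euc n, ℂ) :=
  (((2 * Real.pi) ^ (-(n : ℝ) / 2) : ℝ) : ℂ) •
    ((SchwartzMap.compCLMOfContinuousLinearEquiv ℂ (dilation n)).comp
      (FourierTransform.fourierCLM ℂ 𝓢(Euc n, ℂ)))

theorem fourier_apply (φ : 𝓢(Euc n, ℂ)) (y : Euc n) :
    fourier n φ y = (((2 * Real.pi) ^ (-(n : ℝ) / 2) : ℝ) : ℂ) *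
      ∫ x : Euc n, Complex.exp (-Complex.I * ((inner ℝ y x : ℝ) : ℂ)) * φ x := by
  have h : fourier n φ y = (((2 * Real.pi) ^ (-(n : ℝ) / 2) : ℝ) : ℂ) *
      (𝓕 φ) ((2 * Real.pi)⁻¹ • y) := rfl
  rw [h, SchwartzMap.fourier_coe, Real.fourier_eq']
  congr 1
  refine MeasureTheory.integral_congr_ae (Filter.Eventually.of_forall fun x => ?_)
  have hpi : (Real.pi : ℂ) ≠ 0 := by exact_mod_cast Real.pi_ne_zero
  simp only [smul_eq_mul, real_inner_smul_right, real_inner_comm]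
  congr 2
  push_cast
  field_simp

/-- The Fourier transform of a tempered distribution, `⟨û, φ⟩ = ⟨u, φ̂⟩`. -/
def fourierDistribution (u : 𝓢'(Euc n, ℂ)) : 𝓢'(Euc n, ℂ) :=
  PointwiseConvergenceCLM.precomp ℂ (fourier n) u

/-- The tempered distribution `U` is the one defined by the function `u`. -/
def IsDefinedBy (U : 𝓢'(Euc n, ℂ)) (u : Euc n → ℂ) : Prop :=
  ∀ φ : 𝓢(Euc n, ℂ), MeasureTheory.Integrable (fun x => u x * φ x) ∧
    U φ = ∫ x : Euc n, u x * φ x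

/-- The restriction of the tempered distribution `U` to the open set `ℝⁿ ∖ {0}` is the
distribution defined there by the function `g`. -/
def RestrictsOffOriginTo (U : 𝓢'(Euc n, ℂ)) (g : Euc n → ℂ) : Prop :=
  ∀ φ : 𝓢(Euc n, ℂ), HasCompactSupport φ → tsupport φ ⊆ {0}ᶜ →
    MeasureTheory.Integrable (fun x => g x * φ x) ∧ U φ = ∫ x : Euc n, g x * φ x

/-! ### The momentum ray transform and its normal operator -/

/-- `T𝕊^{n-1} = {(x, ξ) : |ξ| = 1, ⟨x, ξ⟩ = 0}`, the manifold of oriented lines in `ℝⁿ`. -/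
abbrev TSphere (n : ℕ) : Type :=
  {p : Euc n × Euc n // ‖p.2‖ = 1 ∧ (inner ℝ p.1 p.2 : ℝ) = 0}

/-- The line through `x` in the direction `ξ`, that is, the point `(x - ⟨x, ξ⟩ ξ, ξ)`. -/
def lineThrough (x : Euc n) (ξ : Metric.sphere (0 : Euc n) 1) : TSphere n :=
  ⟨(x - (inner ℝ x (ξ : Euc n) : ℝ) • (ξ : Euc n), (ξ : Euc n)), by
    have h : ‖(ξ : Euc n)‖ = 1 := by simp
    refine ⟨h, ?_⟩
    simp [inner_sub_left, real_inner_smul_left, h]⟩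

/-- The momentum ray transform
`I_m^k f(x, ξ) = ∫ t^k f_{i₁…i_m}(x + tξ) ξ^{i₁} ⋯ ξ^{i_m} dt`. -/
def momentumRay (k : ℕ) (f : (Fin m → Fin n) → 𝓢(Euc n, ℂ)) (p : TSphere n) : ℂ :=
  ∫ t : ℝ, (t : ℂ) ^ k *
    ∑ i : Fin m → Fin n, f i (p.1.1 + t • p.1.2) * ∏ a, ((p.1.2 (i a) : ℝ) : ℂ)

/-- The formal `L²`-adjoint of `I_m^k`:
`((I_m^k)^* φ)_{i₁…i_m}(x) = ∫_{𝕊^{n-1}} ⟨x, ξ⟩^k ξ_{i₁} ⋯ ξ_{i_m} φ(x - ⟨x, ξ⟩ ξ, ξ) dξ`,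
where `dξ` is the surface measure of the unit sphere. -/
def momentumRayAdjoint (m k : ℕ) (φ : TSphere n → ℂ) (x : Euc n) : Tensor n m :=
  fun i => ∫ ξ : Metric.sphere (0 : Euc n) 1,
    ((inner ℝ x (ξ : Euc n) : ℝ) : ℂ) ^ k * (∏ a, (((ξ : Euc n) (i a) : ℝ) : ℂ)) *
      φ (lineThrough x ξ) ∂(MeasureTheory.volume : MeasureTheory.Measure (Euc n)).toSphere

/-- The normal operator `N_m^k = (I_m^k)^* I_m^k`. -/
def normalOp (k : ℕ) (f : (Fin m → Fin n) → 𝓢(Euc n, ℂ)) : Euc n → Tensor n m :=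
  momentumRayAdjoint m k (momentumRay k f)

/-- The tensor field
`F^{(m,k)}(y) = 2^{m-2} (2m-1)!! Γ((2m+n-1)/2) / (π^{(n+1)/2} k!) j_y^k G(y)`
of rank `m - k`, to be used with `G` the Fourier transform of `N_m^k f`. For `m = 0` the natural
number `2 * m - 1` is `0`, and `0‼ = 1` is the value of `(-1)!!`. -/
def tensorF {k : ℕ} (hk : k ≤ m) (G : Euc n → Tensor n m) (y : Euc n) : Tensor n (m - k) :=
  (((2 : ℝ) ^ ((m : ℤ) - 2) * (Nat.doubleFactorial (2 * m - 1) : ℝ) *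
      Real.Gamma ((2 * (m : ℝ) + (n : ℝ) - 1) / 2) /
    (Real.pi ^ (((n : ℝ) + 1) / 2) * (k.factorial : ℝ)) : ℝ) : ℂ) •
    contractVecPow y k (castRank (Nat.sub_add_cancel hk).symm (G y))

end MomentumRay

end

/-!
In polar coordinates each component of `N_m^k f` becomes a sum of monomials times convolutions of
`f` with kernels `w_R |w|^(-|R| - n + 1)`. By Gaussian subordination the Fourier transform of such a
kernel with `|R| = 2p` is, off the origin, a constant `κ_p` times `∂_R |y|^(2p - 1)`. Hence the
Fourier transform of `N_m^k f` is there, up to a power of `i`, the `k`-fold divergence of a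
symmetric field `S` of rank `m + k`, and `j_y S = 0` by Euler's identity for homogeneous functions.
Commuting `j_y` past the divergences gives `j_y^k div^k S = (-1)^k k! tr^k S`; each trace is a
Laplacian of a power of `|y|`.
-/

noncomputable section

namespace MomentumRay

open Set Filter MeasureTheory
open scoped Topology LineDeriv

variable {n m : ℕ}

section Calculus

variable {Ω : Set (Euc n)} {u v : Euc n → ℂ} {y : Euc n}

theorem contDiff_coord (i : Fin n) : ContDiff ℝ ∞ (fun y : Euc n => ((y i : ℝ) : ℂ)) :=
  Complex.ofRealCLM.contDiff.comp (EuclideanSpace.proj (𝕜 := ℝ) i).contDiff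

theorem differentiableAt_of_contDiffOn (hΩ : IsOpen Ω) (hu : ContDiffOn ℝ ∞ u Ω) (hy : y ∈ Ω) :
    DifferentiableAt ℝ u y :=
  (hu.contDiffAt (hΩ.mem_nhds hy)).differentiableAt (by simp)

theorem contDiffOn_partialDeriv (hΩ : IsOpen Ω) (hu : ContDiffOn ℝ ∞ u Ω) (i : Fin n) :
    ContDiffOn ℝ ∞ (partialDeriv i u) Ω :=
  (hu.fderiv_of_isOpen hΩ (by simp)).clm_apply contDiffOn_const

theorem partialDeriv_eqOn (hΩ : IsOpen Ω) (h : EqOn u v Ω) (i : Fin n) :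
    EqOn (partialDeriv i u) (partialDeriv i v) Ω := fun y hy => by
  rw [partialDeriv, partialDeriv, (eventuallyEq_of_mem (hΩ.mem_nhds hy) h).fderiv_eq]

theorem partialDeriv_const (c : ℂ) (i : Fin n) (y : Euc n) :
    partialDeriv i (fun _ => c) y = 0 := by
  simp [partialDeriv]

theorem partialDeriv_coord (i j : Fin n) (y : Euc n) :
    partialDeriv i (fun z : Euc n => ((z j : ℝ) : ℂ)) y = if j = i then 1 else 0 := by
  have h : HasFDerivAt (fun z : Euc n => ((z j : ℝ) : ℂ))
      (Complex.ofRealCLM.comp (EuclideanSpace.proj (𝕜 := ℝ) j)) y :=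
    (Complex.ofRealCLM.comp (EuclideanSpace.proj (𝕜 := ℝ) j)).hasFDerivAt
  rw [partialDeriv, h.fderiv]
  by_cases hji : j = i <;> simp [hji]

theorem partialDeriv_mul (hu : DifferentiableAt ℝ u y) (hv : DifferentiableAt ℝ v y) (i : Fin n) :
    partialDeriv i (fun z => u z * v z) y =
      u y * partialDeriv i v y + v y * partialDeriv i u y := by
  simp only [partialDeriv]
  rw [fderiv_fun_mul hu hv]
  simp

theorem partialDeriv_const_mul (hu : DifferentiableAt ℝ u y) (c : ℂ) (i : Fin n) :
    partialDeriv i (fun z => c * u z) y = c * partialDeriv i u y := by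
  rw [partialDeriv_mul (differentiableAt_const c) hu, partialDeriv_const, mul_zero, add_zero]

theorem partialDeriv_sum {ι : Type*} {s : Finset ι} {u : ι → Euc n → ℂ}
    (hu : ∀ i ∈ s, DifferentiableAt ℝ (u i) y) (j : Fin n) :
    partialDeriv j (fun z => ∑ i ∈ s, u i z) y = ∑ i ∈ s, partialDeriv j (u i) y := by
  simp only [partialDeriv]
  rw [fderiv_fun_sum hu]
  simp

theorem partialDeriv_comm (hu : ContDiffAt ℝ 2 u y) (i j : Fin n) :
    partialDeriv i (partialDeriv j u) y = partialDeriv j (partialDeriv i u) y := by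
  have hd : DifferentiableAt ℝ (fderiv ℝ u) y :=
    (hu.fderiv_right (m := 1) (by norm_num)).differentiableAt (by simp)
  have second (a b : Fin n) : partialDeriv a (partialDeriv b u) y =
      fderiv ℝ (fderiv ℝ u) y (EuclideanSpace.single a 1) (EuclideanSpace.single b 1) := by
    change fderiv ℝ (fun z => fderiv ℝ u z (EuclideanSpace.single b 1)) y _ = _
    simp [fderiv_clm_apply hd (differentiableAt_const _)]
  rw [second, second]
  exact (hu.isSymmSndFDerivAt (by simp [minSmoothness_of_isRCLikeNormedField])).eq _ _

/-- The iterated partial derivative `∂_{i₁} ⋯ ∂_{i_r} u`. The multi-index is a list, so that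
derivatives compose by appending lists and commute by permuting them. -/
def iterDeriv : List (Fin n) → (Euc n → ℂ) → Euc n → ℂ
  | [], u => u
  | i :: R, u => partialDeriv i (iterDeriv R u)

theorem iterDeriv_cons (i : Fin n) (R : List (Fin n)) (u : Euc n → ℂ) :
    iterDeriv (i :: R) u = partialDeriv i (iterDeriv R u) := rfl

theorem iterDeriv_append (R R' : List (Fin n)) (u : Euc n → ℂ) :
    iterDeriv (R ++ R') u = iterDeriv R (iterDeriv R' u) := by
  induction R with
  | nil => rfl
  | cons i R ih => rw [List.cons_append, iterDeriv_cons, ih, iterDeriv_cons]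

theorem contDiffOn_iterDeriv (hΩ : IsOpen Ω) (hu : ContDiffOn ℝ ∞ u Ω) (R : List (Fin n)) :
    ContDiffOn ℝ ∞ (iterDeriv R u) Ω := by
  induction R with
  | nil => exact hu
  | cons i R ih => exact contDiffOn_partialDeriv hΩ ih i

theorem iterDeriv_eqOn (hΩ : IsOpen Ω) (h : EqOn u v Ω) (R : List (Fin n)) :
    EqOn (iterDeriv R u) (iterDeriv R v) Ω := by
  induction R with
  | nil => exact h
  | cons i R ih => exact partialDeriv_eqOn hΩ ih i

theorem iterDeriv_perm (hΩ : IsOpen Ω) (hu : ContDiffOn ℝ ∞ u Ω) {R R' : List (Fin n)}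
    (h : R.Perm R') : EqOn (iterDeriv R u) (iterDeriv R' u) Ω := by
  induction h with
  | nil => exact fun _ _ => rfl
  | cons i _ ih => exact partialDeriv_eqOn hΩ ih i
  | swap i j R =>
    exact fun y hy => partialDeriv_comm (((contDiffOn_iterDeriv hΩ hu R).contDiffAt
      (hΩ.mem_nhds hy)).of_le (by norm_cast)) j i
  | trans _ _ ih₁ ih₂ => exact ih₁.trans ih₂

theorem iterDeriv_const_mul (hΩ : IsOpen Ω) (hu : ContDiffOn ℝ ∞ u Ω) (c : ℂ) (R : List (Fin n)) :
    EqOn (iterDeriv R (fun z => c * u z)) (fun y => c * iterDeriv R u y) Ω := by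
  induction R with
  | nil => exact fun _ _ => rfl
  | cons i R ih =>
    exact fun y hy => (partialDeriv_eqOn hΩ ih i hy).trans (partialDeriv_const_mul
      (differentiableAt_of_contDiffOn hΩ (contDiffOn_iterDeriv hΩ hu R) hy) c i)

theorem iterDeriv_sum {ι : Type*} {s : Finset ι} {u : ι → Euc n → ℂ} (hΩ : IsOpen Ω)
    (hu : ∀ i ∈ s, ContDiffOn ℝ ∞ (u i) Ω) (R : List (Fin n)) :
    EqOn (iterDeriv R (fun z => ∑ i ∈ s, u i z)) (fun y => ∑ i ∈ s, iterDeriv R (u i) y) Ω := by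
  induction R with
  | nil => exact fun _ _ => rfl
  | cons i R ih =>
    exact fun y hy => (partialDeriv_eqOn hΩ ih i hy).trans (partialDeriv_sum (fun j hj =>
      differentiableAt_of_contDiffOn hΩ (contDiffOn_iterDeriv hΩ (hu j hj) R) hy) i)

end Calculus

/-- The components of a tensor field, indexed by lists. The rank is the length of the list and is
not fixed, which avoids casts between tensors of ranks such as `(m - k) + k` and `m`. -/
abbrev ListField (n : ℕ) : Type := List (Fin n) → Euc n → ℂ

namespace ListField

/-- The field is smooth on `Ω` and symmetric in all its indices there. -/
structure IsSmoothSymmOn (S : ListField n) (Ω : Set (Euc n)) : Prop where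
  perm : ∀ {R R' : List (Fin n)}, R.Perm R' → EqOn (S R) (S R') Ω
  smooth : ∀ R, ContDiffOn ℝ ∞ (S R) Ω

/-- The divergence `∂^l S_{l X}`. -/
def divergence (S : ListField n) : ListField n := fun X y => ∑ l, partialDeriv l (S (l :: X)) y

/-- The contraction `y^l S_{l X}(y)` with the position vector, that is, `j_y S`. -/
def contractPos (S : ListField n) : ListField n := fun X y => ∑ l, ((y l : ℝ) : ℂ) * S (l :: X) y

/-- The trace `S_{l l X}`. -/
def trace (S : ListField n) : ListField n := fun X y => ∑ l, S (l :: l :: X) y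

variable {S S' : ListField n} {Ω : Set (Euc n)} {y : Euc n}

theorem divergence_congr (hΩ : IsOpen Ω) (h : ∀ X, EqOn (S X) (S' X) Ω) (X : List (Fin n)) :
    EqOn (divergence S X) (divergence S' X) Ω :=
  fun _ hy => Finset.sum_congr rfl fun l _ => partialDeriv_eqOn hΩ (h _) l hy

theorem contractPos_congr (h : ∀ X, S X y = S' X y) (X : List (Fin n)) :
    contractPos S X y = contractPos S' X y :=
  Finset.sum_congr rfl fun l _ => by rw [h]

theorem iterate_contractPos_congr (h : ∀ X, S X y = S' X y) (k : ℕ) (X : List (Fin n)) :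
    contractPos^[k] S X y = contractPos^[k] S' X y := by
  induction k generalizing S S' X with
  | zero => exact h X
  | succ _ ih => exact ih (fun X => contractPos_congr h X) X

theorem iterate_contractPos_smul (c : ℂ) (k : ℕ) (S : ListField n) :
    contractPos^[k] (c • S) = c • contractPos^[k] S := by
  have h : Function.Commute (contractPos (n := n)) (c • ·) := fun S => by
    funext X y
    simp only [contractPos, Pi.smul_apply, smul_eq_mul, Finset.mul_sum, mul_left_comm]
  exact h.iterate_left k S

theorem IsSmoothSymmOn.divergence (h : S.IsSmoothSymmOn Ω) (hΩ : IsOpen Ω) :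
    S.divergence.IsSmoothSymmOn Ω where
  perm hR _ hy := Finset.sum_congr rfl fun l _ => partialDeriv_eqOn hΩ (h.perm (hR.cons l)) l hy
  smooth _ := ContDiffOn.sum fun l _ => contDiffOn_partialDeriv hΩ (h.smooth _) l

theorem IsSmoothSymmOn.iterate_divergence (h : S.IsSmoothSymmOn Ω) (hΩ : IsOpen Ω) (k : ℕ) :
    IsSmoothSymmOn (ListField.divergence^[k] S) Ω :=
  Function.Iterate.rec (fun S : ListField n => S.IsSmoothSymmOn Ω)
    h (fun _ hS => hS.divergence hΩ) k

theorem IsSmoothSymmOn.trace (h : S.IsSmoothSymmOn Ω) : S.trace.IsSmoothSymmOn Ω where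
  perm hR _ hy := Finset.sum_congr rfl fun l _ => h.perm ((hR.cons l).cons l) hy
  smooth _ := ContDiffOn.sum fun _ _ => h.smooth _

theorem partialDeriv_contractPos {X : List (Fin n)}
    (hS : ∀ i, DifferentiableAt ℝ (S (i :: X)) y) (l : Fin n) :
    partialDeriv l (contractPos S X) y =
      (∑ i, ((y i : ℝ) : ℂ) * partialDeriv l (S (i :: X)) y) + S (l :: X) y := by
  have hcoord (i : Fin n) : DifferentiableAt ℝ (fun z : Euc n => ((z i : ℝ) : ℂ)) y :=
    (contDiff_coord i).differentiable (by simp) y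
  refine (partialDeriv_sum (s := Finset.univ) (fun i _ => (hcoord i).fun_mul (hS i)) l).trans ?_
  simp [partialDeriv_mul (hcoord _) (hS _), partialDeriv_coord, Finset.sum_add_distrib]

theorem contractPos_divergence (h : S.IsSmoothSymmOn Ω) (hΩ : IsOpen Ω) (X : List (Fin n))
    (hy : y ∈ Ω) :
    contractPos (divergence S) X y = divergence (contractPos S) X y - trace S X y := by
  have leibniz (l : Fin n) := partialDeriv_contractPos (X := l :: X)
    (fun i => differentiableAt_of_contDiffOn hΩ (h.smooth (i :: l :: X)) hy) l
  have swap (i l : Fin n) := partialDeriv_eqOn hΩ (h.perm (List.Perm.swap i l X)) l hy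
  rw [divergence, Finset.sum_congr rfl fun l _ => leibniz l, Finset.sum_add_distrib,
    Finset.sum_comm, trace, add_sub_cancel_right]
  simp only [contractPos, divergence, Finset.mul_sum, swap]

theorem trace_divergence (h : S.IsSmoothSymmOn Ω) (hΩ : IsOpen Ω) (X : List (Fin n)) :
    EqOn (trace (divergence S) X) (divergence (trace S) X) Ω := fun y hy => by
  have expand : divergence (trace S) X y = ∑ l, ∑ i, partialDeriv l (S (i :: i :: l :: X)) y :=
    Finset.sum_congr rfl fun l _ => partialDeriv_sum
      (fun i _ => differentiableAt_of_contDiffOn hΩ (h.smooth (i :: i :: l :: X)) hy) l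
  rw [expand, Finset.sum_comm]
  exact Finset.sum_congr rfl fun i _ => Finset.sum_congr rfl fun l _ => partialDeriv_eqOn hΩ
    (h.perm ((List.Perm.swap i l _).trans ((List.Perm.swap i l _).cons i))) l hy

theorem trace_iterate_divergence (h : S.IsSmoothSymmOn Ω) (hΩ : IsOpen Ω) (k : ℕ)
    (X : List (Fin n)) :
    EqOn (trace (divergence^[k] S) X) (divergence^[k] (trace S) X) Ω := by
  induction k generalizing X with
  | zero => exact fun _ _ => rfl
  | succ k ih =>
    rw [Function.iterate_succ_apply', Function.iterate_succ_apply']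
    exact (trace_divergence (h.iterate_divergence hΩ k) hΩ X).trans (divergence_congr hΩ ih X)

theorem contractPos_trace (h : S.IsSmoothSymmOn Ω) (X : List (Fin n)) (hy : y ∈ Ω) :
    contractPos (trace S) X y = trace (contractPos S) X y := by
  simp only [contractPos, trace, Finset.mul_sum]
  rw [Finset.sum_comm]
  refine Finset.sum_congr rfl fun i _ => Finset.sum_congr rfl fun l _ => ?_
  rw [h.perm (((List.Perm.swap l i X).cons i).trans (List.Perm.swap l i _)) hy]

theorem contractPos_iterate_divergence (h : S.IsSmoothSymmOn Ω) (hΩ : IsOpen Ω)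
    (h0 : ∀ X, EqOn (contractPos S X) 0 Ω) (k : ℕ) (X : List (Fin n)) :
    EqOn (contractPos (divergence^[k + 1] S) X)
      (fun y => -(k + 1 : ℂ) * divergence^[k] (trace S) X y) Ω := by
  induction k generalizing X with
  | zero =>
    intro y hy
    have hdiv : divergence (contractPos S) X y = 0 := by
      rw [divergence_congr (S' := fun _ => 0) hΩ h0 X hy]
      exact Finset.sum_eq_zero fun l _ => partialDeriv_const 0 l y
    simp [contractPos_divergence h hΩ X hy, hdiv]
  | succ k ih =>
    intro y hy
    have hdiv : divergence (contractPos (divergence^[k + 1] S)) X y =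
        -(k + 1 : ℂ) * divergence^[k + 1] (trace S) X y := by
      rw [divergence_congr hΩ ih X hy, Function.iterate_succ_apply' divergence k (trace S)]
      simp only [divergence, Finset.mul_sum]
      exact Finset.sum_congr rfl fun l _ => partialDeriv_const_mul (differentiableAt_of_contDiffOn
        hΩ ((h.trace.iterate_divergence hΩ k).smooth (l :: X)) hy) _ l
    rw [Function.iterate_succ_apply', contractPos_divergence (h.iterate_divergence hΩ _) hΩ X hy,
      hdiv, trace_iterate_divergence h hΩ _ X hy]
    push_cast
    ring

theorem iterate_contractPos_iterate_divergence (h : S.IsSmoothSymmOn Ω) (hΩ : IsOpen Ω)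
    (h0 : ∀ X, EqOn (contractPos S X) 0 Ω) (k : ℕ) (X : List (Fin n)) (hy : y ∈ Ω) :
    contractPos^[k] (divergence^[k] S) X y = (-1) ^ k * (k.factorial : ℂ) * trace^[k] S X y := by
  induction k generalizing S X with
  | zero => simp
  | succ k ih =>
    have htrace (X) : EqOn (contractPos (trace S) X) 0 Ω := fun z hz => by
      rw [contractPos_trace h X hz]
      exact Finset.sum_eq_zero fun l _ => h0 _ hz
    rw [Function.iterate_succ_apply,
      iterate_contractPos_congr (S' := (-(k + 1 : ℂ)) • divergence^[k] (trace S))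
        (fun X => contractPos_iterate_divergence h hΩ h0 k X hy),
      iterate_contractPos_smul, Pi.smul_apply, Pi.smul_apply, ih h.trace htrace,
      Function.iterate_succ_apply, Nat.factorial_succ, smul_eq_mul]
    push_cast
    ring

end ListField

open ListField

section TestFunctions

/-- A test function on the open set `Ω`, that is, a smooth function whose support is a compact
subset of `Ω`. -/
structure IsTestOn (Ω : Set (Euc n)) (φ : Euc n → ℂ) : Prop where
  smooth : ContDiff ℝ ∞ φ
  compact : HasCompactSupport φ
  tsupport_subset : tsupport φ ⊆ Ω

variable {Ω : Set (Euc n)} {u φ : Euc n → ℂ}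

theorem IsTestOn.partialDeriv (h : IsTestOn Ω φ) (i : Fin n) : IsTestOn Ω (partialDeriv i φ) := by
  have hsub : tsupport (MomentumRay.partialDeriv i φ) ⊆ tsupport φ :=
    tsupport_fderiv_apply_subset ℝ _
  exact ⟨(h.smooth.fderiv_right (by simp)).clm_apply contDiff_const,
    h.compact.of_isClosed_subset (isClosed_tsupport _) hsub, hsub.trans h.tsupport_subset⟩

theorem IsTestOn.iterDeriv (h : IsTestOn Ω φ) (R : List (Fin n)) : IsTestOn Ω (iterDeriv R φ) := by
  induction R with
  | nil => exact h
  | cons i R ih => exact ih.partialDeriv i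

theorem IsTestOn.integrable_mul (h : IsTestOn Ω φ) (hΩ : IsOpen Ω) (hu : ContinuousOn u Ω) :
    Integrable (fun y => u y * φ y) := by
  have hcont : Continuous (fun y => u y * φ y) := continuous_of_tsupport fun y hy =>
    (hu.continuousAt (hΩ.mem_nhds (h.tsupport_subset (tsupport_mul_subset_right hy)))).mul
      h.smooth.continuous.continuousAt
  exact hcont.integrable_of_hasCompactSupport h.compact.mul_left

theorem integral_partialDeriv_mul (hΩ : IsOpen Ω) (hu : ContDiffOn ℝ ∞ u Ω) (h : IsTestOn Ω φ)
    (i : Fin n) : ∫ y, partialDeriv i u y * φ y = -∫ y, u y * partialDeriv i φ y :=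
  (neg_eq_iff_eq_neg.2 (integral_mul_fderiv_eq_neg_fderiv_mul_of_integrable (μ := volume)
    (h.integrable_mul hΩ (contDiffOn_partialDeriv hΩ hu i).continuousOn)
    ((h.partialDeriv i).integrable_mul hΩ hu.continuousOn)
    (h.integrable_mul hΩ hu.continuousOn)
    (fun _ hx => differentiableAt_of_contDiffOn hΩ hu (h.tsupport_subset hx))
    (fun x _ => h.smooth.differentiable (by simp) x))).symm

theorem integral_iterDeriv_mul (hΩ : IsOpen Ω) (hu : ContDiffOn ℝ ∞ u Ω) (h : IsTestOn Ω φ)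
    (R : List (Fin n)) :
    ∫ y, iterDeriv R u y * φ y = (-1) ^ R.length * ∫ y, u y * iterDeriv R φ y := by
  have hrev : iterDeriv R.reverse φ = iterDeriv R φ :=
    (eqOn_univ _ _).1 (iterDeriv_perm isOpen_univ h.smooth.contDiffOn R.reverse_perm)
  rw [← hrev]
  clear hrev
  induction R generalizing φ with
  | nil => simp [iterDeriv]
  | cons i R ih =>
    rw [iterDeriv_cons, integral_partialDeriv_mul hΩ (contDiffOn_iterDeriv hΩ hu R) h,
      ih (h.partialDeriv i), List.reverse_cons, iterDeriv_append, List.length_cons, pow_succ,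
      mul_neg_one, neg_mul]
    rfl

theorem integral_iterate_divergence_mul (hΩ : IsOpen Ω) {S : ListField n}
    (hS : S.IsSmoothSymmOn Ω) (h : IsTestOn Ω φ) (k : ℕ) (X : List (Fin n)) :
    ∫ y, divergence^[k] S X y * φ y =
      (-1) ^ k * ∑ K : Fin k → Fin n,
        ∫ y, S (List.ofFn K ++ X) y * iterDeriv (List.ofFn K) φ y := by
  induction k generalizing φ X with
  | zero => simp [iterDeriv]
  | succ k ih =>
    have smooth (l : Fin n) := (hS.iterate_divergence hΩ k).smooth (l :: X)
    have hsum : ∫ y, divergence^[k + 1] S X y * φ y =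
        ∑ l, ∫ y, partialDeriv l (divergence^[k] S (l :: X)) y * φ y := by
      rw [Function.iterate_succ_apply']
      simp only [divergence, Finset.sum_mul]
      exact integral_finsetSum _ fun l _ =>
        h.integrable_mul hΩ (contDiffOn_partialDeriv hΩ (smooth l) l).continuousOn
    have ofFn_snoc (l : Fin n) (K : Fin k → Fin n) :
        List.ofFn (Fin.snocEquiv (fun _ => Fin n) (l, K)) = List.ofFn K ++ [l] := by
      rw [List.ofFn_succ']
      simp [Fin.snocEquiv]
    simp_rw [hsum, integral_partialDeriv_mul hΩ (smooth _) h, ih (h.partialDeriv _)]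
    rw [← (Fin.snocEquiv fun _ : Fin (k + 1) => Fin n).sum_comp, Fintype.sum_prod_type]
    simp_rw [ofFn_snoc, iterDeriv_append, List.append_assoc, Finset.mul_sum]
    simp [iterDeriv, pow_succ]

end TestFunctions

section HomogeneousFunctions

variable {Ω : Set (Euc n)} {u : Euc n → ℂ} {y : Euc n}

theorem contractPos_iterDeriv_of_euler (hΩ : IsOpen Ω) (hu : ContDiffOn ℝ ∞ u Ω) {c : ℂ}
    (euler : ∀ y ∈ Ω, ∑ l, ((y l : ℝ) : ℂ) * partialDeriv l u y = c * u y) (R : List (Fin n)) :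
    EqOn (contractPos (iterDeriv · u) R) (fun y => (c - R.length) * iterDeriv R u y) Ω := by
  induction R with
  | nil => exact fun y hy => by simpa [contractPos, iterDeriv] using euler y hy
  | cons i R ih =>
    intro y hy
    have hdiff (R : List (Fin n)) :=
      differentiableAt_of_contDiffOn hΩ (contDiffOn_iterDeriv hΩ hu R) hy
    have swap (l : Fin n) := iterDeriv_perm hΩ hu (List.Perm.swap i l R) hy
    have leibniz := partialDeriv_contractPos (S := (iterDeriv · u)) (fun l => hdiff (l :: R)) i
    rw [partialDeriv_eqOn hΩ ih i hy, partialDeriv_const_mul (hdiff R)] at leibniz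
    simp only [contractPos, swap, iterDeriv_cons i, List.length_cons, Nat.cast_succ] at leibniz ⊢
    linear_combination -leibniz

theorem trace_iterDeriv (hΩ : IsOpen Ω) (hu : ContDiffOn ℝ ∞ u Ω) (R : List (Fin n)) :
    EqOn (trace (iterDeriv · u) R)
      (iterDeriv R fun y => ∑ l, partialDeriv l (partialDeriv l u) y) Ω := fun y hy => by
  refine Eq.trans ?_ (iterDeriv_sum (s := Finset.univ) hΩ
    (fun l _ => contDiffOn_iterDeriv hΩ hu [l, l]) R hy).symm
  refine Finset.sum_congr rfl fun l _ => ?_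
  rw [← iterDeriv_append]
  exact iterDeriv_perm hΩ hu (List.perm_append_comm (l₁ := [l, l])) hy

end HomogeneousFunctions

section NormPow

variable {y : Euc n}

/-- The function `|y|^e` with complex values; for `e < 0` its value at the origin is the junk value
`0`. -/
def normPow (e : ℤ) (y : Euc n) : ℂ := ((‖y‖ ^ e : ℝ) : ℂ)

theorem sum_coord_mul_coord (y : Euc n) :
    ∑ l, ((y l : ℝ) : ℂ) * ((y l : ℝ) : ℂ) = ((‖y‖ ^ 2 : ℝ) : ℂ) := by
  rw [EuclideanSpace.real_norm_sq_eq]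
  push_cast
  exact Finset.sum_congr rfl fun l _ => (sq _).symm

theorem contDiffOn_normPow (e : ℤ) : ContDiffOn ℝ ∞ (normPow e : Euc n → ℂ) {0}ᶜ := fun y hy => by
  have hnorm : ContDiffAt ℝ ∞ (fun z : Euc n => ‖z‖) y := contDiffAt_norm ℝ hy
  have hpow : ContDiffAt ℝ ∞ (fun z : Euc n => ‖z‖ ^ e) y := by
    cases e with
    | ofNat a => simpa using hnorm.pow a
    | negSucc a =>
      simp only [zpow_negSucc]
      exact (hnorm.pow (a + 1)).inv (by simpa using hy)
  exact (Complex.ofRealCLM.contDiff.contDiffAt.comp y hpow).contDiffWithinAt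

theorem partialDeriv_normPow (e : ℤ) (i : Fin n) (hy : y ≠ 0) :
    partialDeriv i (normPow e) y = e * (((y i : ℝ) : ℂ) * normPow (e - 2) y) := by
  have hy' : ‖y‖ ≠ 0 := norm_ne_zero_iff.2 hy
  have hnorm : HasFDerivAt (fun z : Euc n => ‖z‖) (‖y‖⁻¹ • innerSL ℝ y) y := by
    have h := (hasStrictFDerivAt_norm_sq y).hasFDerivAt.sqrt (by positivity)
    simp only [Real.sqrt_sq (norm_nonneg _)] at h
    refine h.congr_fderiv (ContinuousLinearMap.ext fun v => ?_)
    simp [field]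
  have hpow := Complex.ofRealCLM.hasFDerivAt.comp y
    ((hasDerivAt_zpow e ‖y‖ (Or.inl hy')).comp_hasFDerivAt y hnorm)
  have hsplit : ‖y‖ ^ (e - 1) = ‖y‖ ^ (e - 2) * ‖y‖ := by
    rw [← zpow_add_one₀ hy', sub_add]
    norm_num
  refine (congrArg (· (EuclideanSpace.single i (1 : ℝ))) hpow.fderiv).trans ?_
  simp only [ContinuousLinearMap.comp_apply, smul_apply, innerSL_apply_apply,
    EuclideanSpace.inner_single_right, Complex.ofRealCLM_apply, normPow, hsplit]
  have hyc : (‖y‖ : ℂ) ≠ 0 := by exact_mod_cast hy'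
  simp [field]

theorem norm_sq_mul_normPow_sub_two (e : ℤ) (hy : y ≠ 0) :
    ((‖y‖ ^ 2 : ℝ) : ℂ) * normPow (e - 2) y = normPow e y := by
  rw [normPow, normPow, ← Complex.ofReal_mul, ← zpow_natCast,
    ← zpow_add₀ (norm_ne_zero_iff.2 hy), Nat.cast_ofNat, add_sub_cancel]

theorem sum_coord_mul_partialDeriv_normPow (e : ℤ) (hy : y ≠ 0) :
    ∑ l, ((y l : ℝ) : ℂ) * partialDeriv l (normPow e) y = e * normPow e y := by
  simp_rw [partialDeriv_normPow e _ hy, ← norm_sq_mul_normPow_sub_two e hy,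
    ← sum_coord_mul_coord, Finset.sum_mul, Finset.mul_sum, mul_assoc, mul_left_comm]

theorem laplacian_normPow (e : ℤ) (hy : y ≠ 0) :
    ∑ l, partialDeriv l (partialDeriv l (normPow e)) y =
      e * (e + n - 2) * normPow (e - 2) y := by
  have hdiff : DifferentiableAt ℝ (normPow (e - 2)) y :=
    differentiableAt_of_contDiffOn isOpen_compl_singleton (contDiffOn_normPow _) hy
  have hcoord (l : Fin n) : DifferentiableAt ℝ (fun z : Euc n => ((z l : ℝ) : ℂ)) y :=
    (contDiff_coord l).differentiable (by simp) y
  have hsecond (l : Fin n) : partialDeriv l (partialDeriv l (normPow e)) y =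
      e * (((y l : ℝ) : ℂ) * partialDeriv l (normPow (e - 2)) y) + e * normPow (e - 2) y := by
    rw [partialDeriv_eqOn isOpen_compl_singleton (fun z hz => partialDeriv_normPow e l hz) l hy,
      partialDeriv_const_mul ((hcoord l).fun_mul hdiff), partialDeriv_mul (hcoord l) hdiff,
      partialDeriv_coord, if_pos rfl]
    ring
  rw [Finset.sum_congr rfl fun l _ => hsecond l, Finset.sum_add_distrib, ← Finset.mul_sum,
    sum_coord_mul_partialDeriv_normPow _ hy, Finset.sum_const, Finset.card_fin, nsmul_eq_mul]
  push_cast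
  ring

theorem contractPos_iterDeriv_normPow (e : ℤ) (R : List (Fin n)) (hy : y ≠ 0) :
    contractPos (iterDeriv · (normPow e)) R y = (e - R.length) * iterDeriv R (normPow e) y :=
  contractPos_iterDeriv_of_euler isOpen_compl_singleton (contDiffOn_normPow e)
    (fun _ hz => sum_coord_mul_partialDeriv_normPow e hz) R hy

theorem trace_iterDeriv_normPow (e : ℤ) (R : List (Fin n)) (hy : y ≠ 0) :
    trace (iterDeriv · (normPow e)) R y =
      e * (e + n - 2) * iterDeriv R (normPow (e - 2)) y := by
  rw [trace_iterDeriv isOpen_compl_singleton (contDiffOn_normPow e) R hy,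
    iterDeriv_eqOn isOpen_compl_singleton (fun z hz => laplacian_normPow e hz) R hy,
    iterDeriv_const_mul isOpen_compl_singleton (contDiffOn_normPow _) _ R hy]

end NormPow

section PolarCoordinates

variable {E F : Type*} [NormedAddCommGroup E] [NormedSpace ℝ E] [NormedAddCommGroup F]

theorem smul_homeomorphUnitSphereProd (x : ({0}ᶜ : Set E)) :
    ((homeomorphUnitSphereProd E x).2 : ℝ) • ((homeomorphUnitSphereProd E x).1 : E) = x :=
  congrArg Subtype.val ((homeomorphUnitSphereProd E).symm_apply_apply x)

theorem integral_volumeIoiPow [NormedSpace ℝ F] (d : ℕ) (g : ℝ → F) :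
    ∫ r, g r ∂Measure.volumeIoiPow d = ∫ r in Ioi (0 : ℝ), r ^ d • g r := by
  simp only [Measure.volumeIoiPow, ENNReal.ofReal]
  rw [integral_withDensity_eq_integral_smul (measurable_subtype_coe.pow_const _).real_toNNReal]
  refine (integral_subtype_comap measurableSet_Ioi fun r : ℝ =>
    Real.toNNReal (r ^ d) • g r).trans (setIntegral_congr_fun measurableSet_Ioi fun r hr => ?_)
  simp [NNReal.smul_def, (pow_pos (mem_Ioi.1 hr) d).le]

variable [FiniteDimensional ℝ E] [MeasurableSpace E] [BorelSpace E] [Nontrivial E]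
  {μ : Measure E} [μ.IsAddHaarMeasure] {f : E → F}

theorem integrable_polarCoord (hf : Integrable f μ) :
    Integrable (fun q : Metric.sphere (0 : E) 1 × Ioi (0 : ℝ) => f (q.2.1 • (q.1 : E)))
      (μ.toSphere.prod (Measure.volumeIoiPow (Module.finrank ℝ E - 1))) := by
  rw [← μ.measurePreserving_homeomorphUnitSphereProd.integrable_comp_emb
    (homeomorphUnitSphereProd E).measurableEmbedding]
  simp only [Function.comp_def, smul_homeomorphUnitSphereProd]
  rw [← restrict_compl_singleton (μ := μ) 0] at hf
  exact (integrableOn_iff_comap_subtypeVal (measurableSet_singleton _).compl).1 hf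

variable [NormedSpace ℝ F]

theorem integral_polarCoord (f : E → F) :
    ∫ q : Metric.sphere (0 : E) 1 × Ioi (0 : ℝ), f (q.2.1 • (q.1 : E))
      ∂μ.toSphere.prod (Measure.volumeIoiPow (Module.finrank ℝ E - 1)) = ∫ x, f x ∂μ := by
  rw [← μ.measurePreserving_homeomorphUnitSphereProd.integral_comp
    (homeomorphUnitSphereProd E).measurableEmbedding]
  simp only [smul_homeomorphUnitSphereProd]
  rw [integral_subtype_comap (measurableSet_singleton _).compl f, restrict_compl_singleton]

theorem integrable_sphere_integral_Ioi (hf : Integrable f μ) :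
    Integrable (fun ξ : Metric.sphere (0 : E) 1 =>
      ∫ r in Ioi (0 : ℝ), r ^ (Module.finrank ℝ E - 1) • f (r • (ξ : E))) μ.toSphere :=
  (integrable_polarCoord hf).integral_prod_left.congr (Eventually.of_forall fun ξ =>
    integral_volumeIoiPow _ fun r => f (r • (ξ : E)))

theorem integral_sphere_integral_Ioi (hf : Integrable f μ) :
    ∫ ξ : Metric.sphere (0 : E) 1,
      (∫ r in Ioi (0 : ℝ), r ^ (Module.finrank ℝ E - 1) • f (r • (ξ : E))) ∂μ.toSphere =
        ∫ x, f x ∂μ := by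
  rw [← integral_polarCoord f, integral_prod _ (integrable_polarCoord hf)]
  exact integral_congr_ae (Eventually.of_forall fun ξ =>
    (integral_volumeIoiPow _ fun r => f (r • (ξ : E))).symm)

end PolarCoordinates

section RayKernel

/-- The monomial `x_{i₁} ⋯ x_{i_r}`. -/
def monomial (R : List (Fin n)) (x : Euc n) : ℂ := (R.map fun i => ((x i : ℝ) : ℂ)).prod

theorem monomial_cons (i : Fin n) (R : List (Fin n)) (x : Euc n) :
    monomial (i :: R) x = ((x i : ℝ) : ℂ) * monomial R x := List.prod_cons

theorem monomial_append (R R' : List (Fin n)) (x : Euc n) :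
    monomial (R ++ R') x = monomial R x * monomial R' x := by simp [monomial]

theorem monomial_ofFn {k : ℕ} (i : Fin k → Fin n) (x : Euc n) :
    monomial (List.ofFn i) x = ∏ a, ((x (i a) : ℝ) : ℂ) := by
  simp [monomial, List.map_ofFn, List.prod_ofFn]

theorem monomial_smul (R : List (Fin n)) (r : ℝ) (x : Euc n) :
    monomial R (r • x) = (r : ℂ) ^ R.length * monomial R x := by
  simp [monomial, List.prod_map_mul]

theorem continuous_monomial (R : List (Fin n)) : Continuous (monomial R) :=
  continuous_list_prod R fun i _ => (contDiff_coord i).continuous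

theorem norm_monomial_le (R : List (Fin n)) (x : Euc n) : ‖monomial R x‖ ≤ ‖x‖ ^ R.length := by
  induction R with
  | nil => simp [monomial]
  | cons i R ih =>
    rw [monomial_cons, norm_mul, List.length_cons, pow_succ', Complex.norm_real]
    exact mul_le_mul (PiLp.norm_apply_le x i) ih (norm_nonneg _) (norm_nonneg _)

/-- The kernel `w_R |w|^{-|R|-n+1}`, homogeneous of degree `1 - n`. Averaging the integrals over
the lines through a point against `ξ_R` is, in polar coordinates, a convolution with it. -/
def rayKernel (R : List (Fin n)) (w : Euc n) : ℂ :=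
  monomial R w * normPow (-(R.length : ℤ) - n + 1) w

theorem measurable_normPow (e : ℤ) : Measurable (normPow e : Euc n → ℂ) :=
  Complex.measurable_ofReal.comp (measurable_norm.pow_const e)

theorem measurable_rayKernel (R : List (Fin n)) : Measurable (rayKernel R) :=
  (continuous_monomial R).measurable.mul (measurable_normPow _)

theorem rayKernel_neg {R : List (Fin n)} (hR : Even R.length) (w : Euc n) :
    rayKernel R (-w) = rayKernel R w := by
  have h := monomial_smul R (-1) w
  rw [neg_one_smul, Complex.ofReal_neg, Complex.ofReal_one, hR.neg_one_pow, one_mul] at h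
  rw [rayKernel, rayKernel, h, normPow, normPow, norm_neg]

theorem zpow_mul_zpow_le (x : ℝ) (a b : ℤ) : x ^ a * x ^ b ≤ x ^ (a + b) := by
  by_cases h : x ≠ 0 ∨ a + b ≠ 0 ∨ a = 0 ∧ b = 0
  · rw [zpow_add' h]
  · have ha : a ≠ 0 := by omega
    rw [show x = 0 by tauto, zero_zpow a ha, zero_mul]
    positivity

theorem integrable_inv_one_add_norm_sq : Integrable (fun s : ℝ => ((1 + ‖s‖) ^ 2)⁻¹) :=
  (integrable_one_add_norm (r := 2) (by simp)).congr (Eventually.of_forall fun s => by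
    beta_reduce
    rw [Real.rpow_neg (by positivity), Real.rpow_two])

theorem exists_norm_le_mul_inv_one_add_sq (h : 𝓢(Euc n, ℂ)) :
    ∃ C, ∀ x, ‖h x‖ ≤ C * ((1 + ‖x‖) ^ 2)⁻¹ := by
  refine ⟨2 ^ 2 * (Finset.Iic (2, 0)).sup (fun m => SchwartzMap.seminorm ℂ m.1 m.2) h,
    fun x => ?_⟩
  have hx := SchwartzMap.one_add_le_sup_seminorm_apply (𝕜 := ℂ) (m := (2, 0)) (k := 2) (n := 0)
    le_rfl le_rfl h x
  rwa [norm_iteratedFDeriv_zero, mul_comm, ← le_div_iff₀ (by positivity), div_eq_mul_inv] at hx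

theorem integrable_line (h : 𝓢(Euc n, ℂ)) {ξ : Euc n} (hξ : ‖ξ‖ = 1) :
    Integrable (fun s : ℝ => h (s • ξ)) := by
  obtain ⟨C, hC⟩ := exists_norm_le_mul_inv_one_add_sq h
  refine (integrable_inv_one_add_norm_sq.const_mul C).mono'
    (h.continuous.comp (by fun_prop)).aestronglyMeasurable (Eventually.of_forall fun s => ?_)
  simpa only [norm_smul, hξ, mul_one] using hC (s • ξ)

theorem integral_line (h : 𝓢(Euc n, ℂ)) {ξ : Euc n} (hξ : ‖ξ‖ = 1) :
    ∫ s : ℝ, h (s • ξ) =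
      (∫ r in Ioi (0 : ℝ), h (r • ξ)) + ∫ r in Ioi (0 : ℝ), h (-(r • ξ)) := by
  have hneg := integral_comp_neg_Ioi (0 : ℝ) fun s : ℝ => h (s • ξ)
  simp only [neg_smul, neg_zero] at hneg
  rw [hneg, ← compl_Ioi, integral_add_compl measurableSet_Ioi (integrable_line h hξ)]

variable [NeZero n]

theorem norm_rayKernel_le (R : List (Fin n)) (w : Euc n) :
    ‖rayKernel R w‖ ≤ (‖w‖ ^ (n - 1))⁻¹ := by
  have hexp : (R.length : ℤ) + (-(R.length : ℤ) - n + 1) = -((n - 1 : ℕ) : ℤ) := by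
    have := NeZero.pos n
    omega
  calc ‖rayKernel R w‖ ≤ ‖w‖ ^ R.length * ‖w‖ ^ (-(R.length : ℤ) - n + 1) := by
        rw [rayKernel, norm_mul, normPow, Complex.norm_real, norm_zpow, norm_norm]
        exact mul_le_mul_of_nonneg_right (norm_monomial_le R w) (by positivity)
    _ ≤ ‖w‖ ^ ((R.length : ℤ) + (-(R.length : ℤ) - n + 1)) := by
        rw [← zpow_natCast]
        exact zpow_mul_zpow_le _ _ _
    _ = (‖w‖ ^ (n - 1))⁻¹ := by rw [hexp, zpow_neg, zpow_natCast]

theorem pow_smul_rayKernel_smul (R : List (Fin n)) {r : ℝ} (hr : 0 < r) {ξ : Euc n}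
    (hξ : ‖ξ‖ = 1) : r ^ (n - 1) • rayKernel R (r • ξ) = monomial R ξ := by
  have hexp : ((n - 1 : ℕ) : ℤ) + (R.length + (-(R.length : ℤ) - n + 1)) = 0 := by
    have := NeZero.pos n
    omega
  have hpow : r ^ (n - 1) * (r ^ R.length * r ^ (-(R.length : ℤ) - n + 1)) = 1 := by
    rw [← zpow_natCast, ← zpow_natCast r R.length, ← zpow_add₀ hr.ne', ← zpow_add₀ hr.ne', hexp,
      zpow_zero]
  rw [rayKernel, monomial_smul, normPow, norm_smul, hξ, mul_one, Real.norm_of_nonneg hr.le,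
    mul_right_comm, ← Complex.ofReal_pow, ← Complex.ofReal_mul, ← Complex.real_smul, smul_smul,
    hpow, one_smul]

/-- The weight `|w|^{1-n} (1 + |w|)^{-2}`, an integrable majorant of the products of the kernels
`rayKernel R` with Schwartz functions. -/
def rayWeight (w : Euc n) : ℝ := (‖w‖ ^ (n - 1))⁻¹ * ((1 + ‖w‖) ^ 2)⁻¹

theorem integrable_rayWeight : Integrable (rayWeight : Euc n → ℝ) := by
  refine (integrable_fun_norm_addHaar (E := Euc n) volume
    (f := fun r => (r ^ (n - 1))⁻¹ * ((1 + r) ^ 2)⁻¹)).2 ?_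
  refine integrable_inv_one_add_norm_sq.integrableOn.congr_fun (fun r hr => ?_) measurableSet_Ioi
  have hr' : 0 < r := hr
  simp only [finrank_euclideanSpace_fin, smul_eq_mul, Real.norm_of_nonneg hr'.le]
  rw [mul_inv_cancel_left₀ (by positivity)]

theorem norm_rayKernel_mul_le (R : List (Fin n)) {h : Euc n → ℂ} {C : ℝ} {w : Euc n}
    (hC : ‖h w‖ ≤ C * ((1 + ‖w‖) ^ 2)⁻¹) : ‖rayKernel R w * h w‖ ≤ C * rayWeight w := by
  rw [norm_mul, rayWeight, mul_left_comm]
  exact mul_le_mul (norm_rayKernel_le R w) hC (norm_nonneg _) (by positivity)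

theorem integrable_rayKernel_mul (R : List (Fin n)) (h : 𝓢(Euc n, ℂ)) :
    Integrable (fun w => rayKernel R w * h w) := by
  obtain ⟨C, hC⟩ := exists_norm_le_mul_inv_one_add_sq h
  exact (integrable_rayWeight.const_mul C).mono'
    ((measurable_rayKernel R).mul h.continuous.measurable).aestronglyMeasurable
    (Eventually.of_forall fun w => norm_rayKernel_mul_le R (hC w))

theorem integral_Ioi_rayKernel_mul (R : List (Fin n)) (g : Euc n → ℂ) {ξ : Euc n}
    (hξ : ‖ξ‖ = 1) :
    ∫ r in Ioi (0 : ℝ), r ^ (Module.finrank ℝ (Euc n) - 1) •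
        (rayKernel R (r • ξ) * g (r • ξ)) =
      monomial R ξ * ∫ r in Ioi (0 : ℝ), g (r • ξ) := by
  rw [finrank_euclideanSpace_fin, ← integral_const_mul]
  refine setIntegral_congr_fun measurableSet_Ioi fun r hr => ?_
  beta_reduce
  rw [← smul_mul_assoc, pow_smul_rayKernel_smul R hr hξ]

theorem integrable_sphere_halfLine {R : List (Fin n)} {g : Euc n → ℂ}
    (hg : Integrable (fun w => rayKernel R w * g w)) :
    Integrable (fun ξ : Metric.sphere (0 : Euc n) 1 =>
      monomial R (ξ : Euc n) * ∫ r in Ioi (0 : ℝ), g (r • (ξ : Euc n)))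
      (volume : Measure (Euc n)).toSphere :=
  (integrable_sphere_integral_Ioi hg).congr (Eventually.of_forall fun ξ =>
    integral_Ioi_rayKernel_mul R g (norm_eq_of_mem_sphere ξ))

theorem integral_sphere_halfLine {R : List (Fin n)} {g : Euc n → ℂ}
    (hg : Integrable (fun w => rayKernel R w * g w)) :
    ∫ ξ : Metric.sphere (0 : Euc n) 1,
      monomial R (ξ : Euc n) * (∫ r in Ioi (0 : ℝ), g (r • (ξ : Euc n)))
      ∂(volume : Measure (Euc n)).toSphere = ∫ w, rayKernel R w * g w := by
  rw [← integral_sphere_integral_Ioi hg]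
  exact integral_congr_ae (Eventually.of_forall fun ξ =>
    (integral_Ioi_rayKernel_mul R g (norm_eq_of_mem_sphere ξ)).symm)

theorem integrable_rayKernel_mul_comp_neg {R : List (Fin n)} (hR : Even R.length)
    (h : 𝓢(Euc n, ℂ)) : Integrable (fun w => rayKernel R w * h (-w)) := by
  simpa only [rayKernel_neg hR] using (integrable_rayKernel_mul R h).comp_neg

theorem integrable_sphere_line {R : List (Fin n)} (hR : Even R.length) (h : 𝓢(Euc n, ℂ)) :
    Integrable (fun ξ : Metric.sphere (0 : Euc n) 1 =>
      monomial R (ξ : Euc n) * ∫ s : ℝ, h (s • (ξ : Euc n)))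
      (volume : Measure (Euc n)).toSphere := by
  simp only [integral_line h (norm_eq_of_mem_sphere _), mul_add]
  exact (integrable_sphere_halfLine (integrable_rayKernel_mul R h)).add
    (integrable_sphere_halfLine (integrable_rayKernel_mul_comp_neg hR h))

theorem integral_sphere_line {R : List (Fin n)} (hR : Even R.length) (h : 𝓢(Euc n, ℂ)) :
    ∫ ξ : Metric.sphere (0 : Euc n) 1,
      monomial R (ξ : Euc n) * (∫ s : ℝ, h (s • (ξ : Euc n)))
      ∂(volume : Measure (Euc n)).toSphere = 2 * ∫ w, rayKernel R w * h w := by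
  have hi := integrable_rayKernel_mul R h
  have hi' := integrable_rayKernel_mul_comp_neg hR h
  have heven : ∫ w, rayKernel R w * h (-w) = ∫ w, rayKernel R w * h w := by
    rw [← integral_neg_eq_self fun w => rayKernel R w * h (-w)]
    simp only [rayKernel_neg hR, neg_neg]
  simp only [integral_line h (norm_eq_of_mem_sphere _), mul_add]
  rw [integral_add (integrable_sphere_halfLine hi) (integrable_sphere_halfLine hi'),
    integral_sphere_halfLine hi, integral_sphere_halfLine hi', heven, two_mul]

end RayKernel

section Fourier

/-- The iterated partial derivative `iterDeriv R u` as a Schwartz function. -/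
def schwartzDeriv : List (Fin n) → 𝓢(Euc n, ℂ) → 𝓢(Euc n, ℂ)
  | [], u => u
  | i :: R, u => ∂_{(EuclideanSpace.single i (1 : ℝ) : Euc n)} (schwartzDeriv R u)

theorem coe_schwartzDeriv (R : List (Fin n)) (u : 𝓢(Euc n, ℂ)) :
    ⇑(schwartzDeriv R u) = iterDeriv R u := by
  induction R with
  | nil => rfl
  | cons i R ih =>
    rw [iterDeriv_cons, ← ih]
    rfl

/-- The product of a Schwartz function with the coordinate `x_j`. -/
def schwartzCoord (j : Fin n) (u : 𝓢(Euc n, ℂ)) : 𝓢(Euc n, ℂ) :=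
  SchwartzMap.smulLeftCLM ℂ (inner ℝ · (EuclideanSpace.single j (1 : ℝ) : Euc n)) u

theorem schwartzCoord_apply (j : Fin n) (u : 𝓢(Euc n, ℂ)) (x : Euc n) :
    schwartzCoord j u x = ((x j : ℝ) : ℂ) * u x := by
  rw [schwartzCoord, SchwartzMap.smulLeftCLM_apply_apply (by fun_prop)]
  simp [EuclideanSpace.inner_single_right]

/-- The product of a Schwartz function with the monomial `monomial R`. -/
def schwartzMonomial : List (Fin n) → 𝓢(Euc n, ℂ) → 𝓢(Euc n, ℂ)
  | [], u => u
  | i :: R, u => schwartzCoord i (schwartzMonomial R u)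

theorem schwartzMonomial_apply (R : List (Fin n)) (u : 𝓢(Euc n, ℂ)) (x : Euc n) :
    schwartzMonomial R u x = monomial R x * u x := by
  induction R with
  | nil => exact (one_mul _).symm
  | cons i R ih => rw [schwartzMonomial, schwartzCoord_apply, ih, monomial_cons, mul_assoc]

theorem fourier_eq_dilation (u : 𝓢(Euc n, ℂ)) (y : Euc n) :
    fourier n u y = (((2 * Real.pi) ^ (-(n : ℝ) / 2) : ℝ) : ℂ) *
      (𝓕 u) ((2 * Real.pi)⁻¹ • y) := rfl

theorem coord_mul_fourier (j : Fin n) (u : 𝓢(Euc n, ℂ)) (w : Euc n) :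
    ((w j : ℝ) : ℂ) * fourier n u w =
      -Complex.I * fourier n (∂_{(EuclideanSpace.single j (1 : ℝ) : Euc n)} u) w := by
  rw [fourier_eq_dilation, fourier_eq_dilation, SchwartzMap.fourier_lineDerivOp_eq,
    smul_apply, SchwartzMap.smulLeftCLM_apply_apply (by fun_prop),
    real_inner_smul_left, EuclideanSpace.inner_single_right]
  have hpi : (Real.pi : ℂ) ≠ 0 := by exact_mod_cast Real.pi_ne_zero
  simp only [smul_eq_mul, Complex.real_smul, one_mul, conj_trivial]
  push_cast
  field_simp
  rw [Complex.I_sq]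
  ring

theorem partialDeriv_comp_smul {u : Euc n → ℂ} (hu : Differentiable ℝ u) (c : ℝ) (j : Fin n)
    (y : Euc n) : partialDeriv j (fun z => u (c • z)) y = c * partialDeriv j u (c • y) := by
  have hd : HasFDerivAt (fun z : Euc n => u (c • z))
      ((fderiv ℝ u (c • y)).comp (c • ContinuousLinearMap.id ℝ (Euc n))) y :=
    (hu _).hasFDerivAt.comp y (c • ContinuousLinearMap.id ℝ (Euc n)).hasFDerivAt
  rw [partialDeriv, partialDeriv, hd.fderiv]
  simp

theorem partialDeriv_unnormalized_fourier (j : Fin n) (u : 𝓢(Euc n, ℂ)) (y : Euc n) :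
    partialDeriv j (𝓕 u : 𝓢(Euc n, ℂ)) y =
      -(2 * Real.pi * Complex.I) * (𝓕 (schwartzCoord j u)) y := by
  have hsmul : 𝓕 (-(2 * Real.pi * Complex.I) • schwartzCoord j u) =
      -(2 * Real.pi * Complex.I) • 𝓕 (schwartzCoord j u) := FourierTransform.fourier_smul _ _
  rw [partialDeriv, ← SchwartzMap.lineDerivOp_apply_eq_fderiv, SchwartzMap.lineDerivOp_fourier_eq,
    ← schwartzCoord, hsmul, smul_apply, smul_eq_mul]

theorem partialDeriv_fourier (j : Fin n) (u : 𝓢(Euc n, ℂ)) (y : Euc n) :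
    partialDeriv j (fourier n u) y = -Complex.I * fourier n (schwartzCoord j u) y := by
  have hd : Differentiable ℝ (𝓕 u : 𝓢(Euc n, ℂ)) := SchwartzMap.differentiable _
  have hdil : Differentiable ℝ fun z : Euc n => (𝓕 u : 𝓢(Euc n, ℂ)) ((2 * Real.pi)⁻¹ • z) :=
    hd.fun_comp (by fun_prop)
  have hpi : (Real.pi : ℂ) ≠ 0 := by exact_mod_cast Real.pi_ne_zero
  have hfun : ⇑(fourier n u) = fun z => (((2 * Real.pi) ^ (-(n : ℝ) / 2) : ℝ) : ℂ) *
      (𝓕 u : 𝓢(Euc n, ℂ)) ((2 * Real.pi)⁻¹ • z) := funext (fourier_eq_dilation u)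
  rw [hfun, partialDeriv_const_mul (hdil y), partialDeriv_comp_smul hd,
    partialDeriv_unnormalized_fourier, fourier_eq_dilation]
  push_cast
  field_simp

theorem monomial_mul_fourier (R : List (Fin n)) (u : 𝓢(Euc n, ℂ)) (w : Euc n) :
    monomial R w * fourier n u w = (-Complex.I) ^ R.length * fourier n (schwartzDeriv R u) w := by
  induction R with
  | nil => simp [monomial, schwartzDeriv]
  | cons i R ih =>
    rw [monomial_cons, mul_assoc, ih, List.length_cons, schwartzDeriv, pow_succ, mul_assoc,
      ← coord_mul_fourier]
    ring

theorem iterDeriv_fourier (R : List (Fin n)) (u : 𝓢(Euc n, ℂ)) :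
    iterDeriv R (fourier n u) =
      fun y => (-Complex.I) ^ R.length * fourier n (schwartzMonomial R u) y := by
  induction R with
  | nil => simp [iterDeriv, schwartzMonomial]
  | cons i R ih =>
    funext y
    rw [iterDeriv_cons, ih, partialDeriv_const_mul (SchwartzMap.differentiableAt _),
      partialDeriv_fourier, List.length_cons, schwartzMonomial]
    ring

theorem fourier_schwartzMonomial (R : List (Fin n)) (u : 𝓢(Euc n, ℂ)) (y : Euc n) :
    fourier n (schwartzMonomial R u) y = Complex.I ^ R.length * iterDeriv R (fourier n u) y := by
  rw [iterDeriv_fourier, ← mul_assoc, ← mul_pow]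
  simp

/-- The Fourier transform of an integrable function, normalized as `fourier n`. -/
def fourierFun (g : Euc n → ℂ) (y : Euc n) : ℂ :=
  (((2 * Real.pi) ^ (-(n : ℝ) / 2) : ℝ) : ℂ) *
    ∫ x : Euc n, Complex.exp (-Complex.I * ((inner ℝ y x : ℝ) : ℂ)) * g x

theorem fourierFun_coe (u : 𝓢(Euc n, ℂ)) : fourierFun u = fourier n u :=
  funext fun y => (fourier_apply u y).symm

theorem fourierFun_eq_vectorFourier (g : Euc n → ℂ) (y : Euc n) :
    fourierFun g y = (((2 * Real.pi) ^ (-(n : ℝ) / 2) : ℝ) : ℂ) *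
      VectorFourier.fourierIntegral Real.fourierChar volume
        ((2 * Real.pi)⁻¹ • innerₗ (Euc n)) g y := by
  have hpi : (Real.pi : ℂ) ≠ 0 := by exact_mod_cast Real.pi_ne_zero
  rw [fourierFun, VectorFourier.fourierIntegral]
  congr 2 with x
  rw [Circle.smul_def, Real.fourierChar_apply, smul_eq_mul, real_inner_comm]
  congr 2
  simp only [LinearMap.smul_apply, innerₗ_apply_apply, smul_eq_mul]
  push_cast
  field_simp

theorem integral_mul_fourierFun {g u : Euc n → ℂ} (hg : Integrable g) (hu : Integrable u) :
    ∫ w, g w * fourierFun u w = ∫ y, fourierFun g y * u y := by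
  have hL : Continuous fun q : Euc n × Euc n =>
      ((2 * Real.pi)⁻¹ • innerₗ (Euc n)) q.1 q.2 := by
    simp only [LinearMap.smul_apply, innerₗ_apply_apply]
    fun_prop
  have hflip := VectorFourier.integral_fourierIntegral_smul_eq_flip Real.continuous_fourierChar
    hL hg hu
  have hsymm : ((2 * Real.pi)⁻¹ • innerₗ (Euc n)).flip = (2 * Real.pi)⁻¹ • innerₗ (Euc n) := by
    ext
    simp [real_inner_comm]
  rw [hsymm] at hflip
  simp only [fourierFun_eq_vectorFourier, mul_left_comm (g _), mul_assoc, integral_const_mul]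
  exact congrArg _ hflip.symm

theorem fourierFun_comp_add_right (h : Euc n → ℂ) (w y : Euc n) :
    fourierFun (fun x => h (x + w)) y =
      Complex.exp (Complex.I * ((inner ℝ y w : ℝ) : ℂ)) * fourierFun h y := by
  have hpi : (Real.pi : ℂ) ≠ 0 := by exact_mod_cast Real.pi_ne_zero
  have hshift := congrFun (VectorFourier.fourierIntegral_comp_add_right Real.fourierChar volume
    ((2 * Real.pi)⁻¹ • innerₗ (Euc n)) h w) y
  rw [Circle.smul_def, Real.fourierChar_apply, smul_eq_mul] at hshift
  rw [fourierFun_eq_vectorFourier, fourierFun_eq_vectorFourier, mul_left_comm]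
  refine congrArg _ (hshift.trans ?_)
  congr 2
  simp only [LinearMap.smul_apply, innerₗ_apply_apply, smul_eq_mul, real_inner_comm]
  push_cast
  field_simp

theorem integrable_gaussian {t : ℝ} (ht : 0 < t) :
    Integrable (fun w : Euc n => ((Real.exp (-t * ‖w‖ ^ 2) : ℝ) : ℂ)) :=
  (GaussianFourier.integrable_cexp_neg_mul_sq_norm_add (V := Euc n) (b := (t : ℂ))
    (by simpa using ht) 0 0).congr (Eventually.of_forall fun w => by simp)

theorem fourierFun_gaussian {t : ℝ} (ht : 0 < t) (y : Euc n) :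
    fourierFun (fun w : Euc n => ((Real.exp (-t * ‖w‖ ^ 2) : ℝ) : ℂ)) y =
      (((2 * t) ^ (-(n : ℝ) / 2) * Real.exp (-(4 * t)⁻¹ * ‖y‖ ^ 2) : ℝ) : ℂ) := by
  have hint : ∫ x : Euc n, Complex.exp (-Complex.I * ((inner ℝ y x : ℝ) : ℂ)) *
      ((Real.exp (-t * ‖x‖ ^ 2) : ℝ) : ℂ) =
      (((Real.pi / t) ^ ((n : ℝ) / 2) * Real.exp (-(4 * t)⁻¹ * ‖y‖ ^ 2) : ℝ) : ℂ) := by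
    refine Eq.trans (integral_congr_ae (Eventually.of_forall fun x => ?_))
      ((GaussianFourier.integral_cexp_neg_mul_sq_norm_add (V := Euc n) (b := (t : ℂ))
        (by simpa using ht) (-Complex.I) y).trans ?_)
    · beta_reduce
      push_cast
      rw [← Complex.exp_add, add_comm]
    · rw [finrank_euclideanSpace, Fintype.card_fin]
      push_cast
      rw [Complex.ofReal_cpow (by positivity), neg_sq, Complex.I_sq]
      push_cast
      congr 2
      field_simp
  have hconst : (2 * Real.pi) ^ (-(n : ℝ) / 2) * (Real.pi / t) ^ ((n : ℝ) / 2) =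
      (2 * t) ^ (-(n : ℝ) / 2) := by
    rw [neg_div, Real.rpow_neg (by positivity), Real.rpow_neg (by positivity),
      ← Real.inv_rpow (by positivity), ← Real.inv_rpow (by positivity),
      ← Real.mul_rpow (by positivity) (by positivity)]
    congr 1
    have := Real.pi_ne_zero
    field_simp
  rw [fourierFun, hint, ← Complex.ofReal_mul, ← mul_assoc, hconst]

theorem integral_gaussian_mul_fourier {t : ℝ} (ht : 0 < t) (u : 𝓢(Euc n, ℂ)) :
    ∫ w, ((Real.exp (-t * ‖w‖ ^ 2) : ℝ) : ℂ) * fourier n u w =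
      (((2 * t) ^ (-(n : ℝ) / 2) : ℝ) : ℂ) *
        ∫ y, ((Real.exp (-(4 * t)⁻¹ * ‖y‖ ^ 2) : ℝ) : ℂ) * u y := by
  rw [← fourierFun_coe, integral_mul_fourierFun (integrable_gaussian ht) u.integrable]
  simp only [fourierFun_gaussian ht, Complex.ofReal_mul, mul_assoc, integral_const_mul]

end Fourier

section ExpRemainder

/-- The remainder `e^{-u} - ∑_{j<p} (-u)^j / j!` of the Taylor expansion of `e^{-u}` at `0`. -/
def expRemainder (p : ℕ) (u : ℝ) : ℝ :=
  Real.exp (-u) - ∑ j ∈ Finset.range p, (-u) ^ j / (j.factorial : ℝ)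

theorem expRemainder_succ (p : ℕ) (u : ℝ) :
    expRemainder (p + 1) u = expRemainder p u - (-u) ^ p / (p.factorial : ℝ) := by
  rw [expRemainder, expRemainder, Finset.sum_range_succ, sub_sub]

theorem expRemainder_succ_zero (p : ℕ) : expRemainder (p + 1) 0 = 0 := by
  simp [expRemainder, Finset.sum_range_succ']

theorem hasDerivAt_expRemainder_succ (p : ℕ) (u : ℝ) :
    HasDerivAt (expRemainder (p + 1)) (-expRemainder p u) u := by
  induction p with
  | zero =>
    have h : expRemainder (0 + 1) = fun u => Real.exp (-u) - 1 := funext fun u => by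
      simp [expRemainder]
    rw [h]
    simpa [expRemainder] using (hasDerivAt_neg u).exp.sub_const 1
  | succ p ih =>
    rw [funext (expRemainder_succ (p + 1))]
    refine (ih.sub (((hasDerivAt_neg u).pow (p + 1)).div_const _)).congr_deriv ?_
    rw [expRemainder_succ, Nat.factorial_succ]
    push_cast
    field_simp
    ring

theorem continuous_expRemainder (p : ℕ) : Continuous (expRemainder p) := by
  unfold expRemainder
  fun_prop

theorem neg_one_pow_mul_expRemainder_mem_Icc (p : ℕ) {u : ℝ} (hu : 0 ≤ u) :
    (-1) ^ p * expRemainder p u ∈ Icc 0 (u ^ p / (p.factorial : ℝ)) := by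
  induction p generalizing u with
  | zero => simpa [expRemainder] using ⟨(Real.exp_pos _).le, hu⟩
  | succ p ih =>
    have hderiv (v : ℝ) : HasDerivAt (fun v => (-1) ^ (p + 1) * expRemainder (p + 1) v)
        ((-1) ^ p * expRemainder p v) v :=
      ((hasDerivAt_expRemainder_succ p v).const_mul _).congr_deriv (by ring)
    have hpow (v : ℝ) : HasDerivAt (fun v => v ^ (p + 1) / ((p + 1).factorial : ℝ))
        (v ^ p / (p.factorial : ℝ)) v := by
      refine ((hasDerivAt_pow (p + 1) v).div_const _).congr_deriv ?_
      rw [Nat.factorial_succ]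
      push_cast
      field_simp
    have hlower : MonotoneOn (fun v => (-1) ^ (p + 1) * expRemainder (p + 1) v) (Ici 0) :=
      monotoneOn_of_hasDerivWithinAt_nonneg (convex_Ici 0)
        (continuous_const.mul (continuous_expRemainder _)).continuousOn
        (fun v _ => (hderiv v).hasDerivWithinAt) fun v hv => (ih (interior_subset hv)).1
    have hupper : MonotoneOn (fun v => v ^ (p + 1) / ((p + 1).factorial : ℝ) -
        (-1) ^ (p + 1) * expRemainder (p + 1) v) (Ici 0) :=
      monotoneOn_of_hasDerivWithinAt_nonneg (convex_Ici 0)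
        (((continuous_pow _).div_const _).sub
          (continuous_const.mul (continuous_expRemainder _))).continuousOn
        (fun v _ => ((hpow v).sub (hderiv v)).hasDerivWithinAt)
        fun v hv => sub_nonneg.2 (ih (interior_subset hv)).2
    have h0 := hlower self_mem_Ici hu hu
    have h1 := hupper self_mem_Ici hu hu
    simp only [expRemainder_succ_zero, mul_zero, sub_zero, zero_pow p.succ_ne_zero, zero_div,
      sub_nonneg] at h0 h1
    exact ⟨h0, h1⟩

theorem abs_expRemainder_le (p : ℕ) {u : ℝ} (hu : 0 ≤ u) : |expRemainder p u| ≤ u ^ p := by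
  obtain ⟨h0, h1⟩ := neg_one_pow_mul_expRemainder_mem_Icc p hu
  rw [← abs_of_nonneg h0, abs_mul, abs_neg_one_pow, one_mul] at h1
  exact h1.trans (div_le_self (by positivity) (by exact_mod_cast p.factorial_pos))

theorem abs_expRemainder_succ_le (p : ℕ) {u : ℝ} (hu : 0 ≤ u) :
    |expRemainder (p + 1) u| ≤ u ^ p := by
  obtain ⟨h0, h1⟩ := neg_one_pow_mul_expRemainder_mem_Icc p hu
  have h : (-1) ^ p * expRemainder (p + 1) u =
      (-1) ^ p * expRemainder p u - u ^ p / (p.factorial : ℝ) := by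
    rw [expRemainder_succ, mul_sub, neg_pow u, ← mul_div_assoc, ← mul_assoc, ← mul_pow]
    norm_num
  calc |expRemainder (p + 1) u| = |(-1) ^ p * expRemainder (p + 1) u| := by
        rw [abs_mul, abs_neg_one_pow, one_mul]
    _ ≤ u ^ p / (p.factorial : ℝ) := by rw [h, abs_le]; constructor <;> linarith
    _ ≤ u ^ p := div_le_self (by positivity) (by exact_mod_cast p.factorial_pos)

variable {p : ℕ} {z : ℝ}

theorem integrableOn_rpow_mul_expRemainder (h0 : -p < z) (h1 : z < 1 - p) :
    IntegrableOn (fun u => u ^ (z - 1) * expRemainder p u) (Ioi 0) := by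
  have hmeas : Measurable fun u : ℝ => u ^ (z - 1) * expRemainder p u :=
    (measurable_id.pow_const _).mul (continuous_expRemainder p).measurable
  have hbound {u : ℝ} {q : ℕ} (hu : 0 < u) (h : |expRemainder p u| ≤ u ^ q) :
      ‖u ^ (z - 1) * expRemainder p u‖ ≤ u ^ (z - 1 + q) := by
    rw [Real.rpow_add_natCast hu.ne', norm_mul, Real.norm_of_nonneg (by positivity)]
    gcongr
    exact h
  rcases p with _ | p
  · simp only [Nat.cast_zero, neg_zero] at h0
    simpa [expRemainder, mul_comm] using Real.GammaIntegral_convergent h0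
  push_cast at h0 h1
  rw [← Ioc_union_Ioi_eq_Ioi zero_le_one, integrableOn_union]
  constructor
  · have hint : IntegrableOn (fun u : ℝ => u ^ (z - 1 + (p + 1 : ℕ))) (Ioc 0 1) :=
      (intervalIntegrable_iff_integrableOn_Ioc_of_le zero_le_one).1
        (intervalIntegral.intervalIntegrable_rpow' (by push_cast; linarith))
    exact hint.mono' hmeas.aestronglyMeasurable ((ae_restrict_iff' measurableSet_Ioc).2
      (Eventually.of_forall fun u hu => hbound hu.1 (abs_expRemainder_le _ hu.1.le)))
  · have hint : IntegrableOn (fun u : ℝ => u ^ (z - 1 + p)) (Ioi 1) :=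
      integrableOn_Ioi_rpow_of_lt (by linarith) one_pos
    exact hint.mono' hmeas.aestronglyMeasurable ((ae_restrict_iff' measurableSet_Ioi).2
      (Eventually.of_forall fun u hu => hbound (one_pos.trans hu)
        (abs_expRemainder_succ_le _ (one_pos.trans hu).le)))

theorem continuousWithinAt_rpow_mul_expRemainder_succ (h : -(p + 1 : ℕ) < z) :
    ContinuousWithinAt (fun u => u ^ z * expRemainder (p + 1) u) (Ici 0) 0 := by
  have hpos : 0 < z + (p + 1 : ℕ) := by linarith
  have hpow : Tendsto (fun u : ℝ => u ^ (z + (p + 1 : ℕ))) (𝓝[≥] 0) (𝓝 0) := by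
    simpa only [Real.zero_rpow hpos.ne'] using
      ((Real.continuousAt_rpow_const 0 _ (Or.inr hpos.le)).tendsto.mono_left nhdsWithin_le_nhds)
  rw [ContinuousWithinAt, expRemainder_succ_zero, mul_zero]
  refine squeeze_zero_norm' (eventually_mem_nhdsWithin.mono fun u hu => ?_) hpow
  rcases eq_or_lt_of_le (mem_Ici.1 hu) with rfl | hu
  · rw [expRemainder_succ_zero, mul_zero, norm_zero, Real.zero_rpow hpos.ne']
  · rw [Real.rpow_add_natCast hu.ne', norm_mul, Real.norm_of_nonneg (by positivity)]
    gcongr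
    exact abs_expRemainder_le _ hu.le

theorem tendsto_rpow_mul_expRemainder_succ (h : z < -p) :
    Tendsto (fun u => u ^ z * expRemainder (p + 1) u) atTop (𝓝 0) := by
  have hpow : Tendsto (fun u : ℝ => u ^ (z + p)) atTop (𝓝 0) := by
    simpa using tendsto_rpow_neg_atTop (y := -(z + p)) (by linarith)
  refine squeeze_zero_norm' ((eventually_gt_atTop 0).mono fun u hu => ?_) hpow
  rw [Real.rpow_add_natCast hu.ne', norm_mul, Real.norm_of_nonneg (by positivity)]
  gcongr
  exact abs_expRemainder_succ_le p hu.le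

/-- The Cauchy–Saalschütz formula. -/
theorem integral_rpow_mul_expRemainder (h0 : -p < z) (h1 : z < 1 - p) :
    ∫ u in Ioi (0 : ℝ), u ^ (z - 1) * expRemainder p u = Real.Gamma z := by
  induction p generalizing z with
  | zero =>
    rw [Real.Gamma_eq_integral (by simpa using h0)]
    simp [expRemainder, mul_comm]
  | succ p ih =>
    push_cast at h0 h1
    have : (0 : ℝ) ≤ p := p.cast_nonneg
    have hz : z < 0 := by linarith
    have hderiv (u : ℝ) (hu : u ∈ Ioi 0) : HasDerivAt (fun u => u ^ z * expRemainder (p + 1) u)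
        (z * (u ^ (z - 1) * expRemainder (p + 1) u) - u ^ (z + 1 - 1) * expRemainder p u) u := by
      refine ((Real.hasDerivAt_rpow_const (Or.inl (ne_of_gt hu))).mul
        (hasDerivAt_expRemainder_succ p u)).congr_deriv ?_
      rw [add_sub_cancel_right]
      ring
    have hint := (integrableOn_rpow_mul_expRemainder (p := p + 1) (z := z) (by push_cast; linarith)
      (by push_cast; linarith)).const_mul z
    have hint' := integrableOn_rpow_mul_expRemainder (p := p) (z := z + 1) (by linarith)
      (by linarith)
    have hzero := integral_Ioi_of_hasDerivAt_of_tendsto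
      (continuousWithinAt_rpow_mul_expRemainder_succ (by push_cast; linarith)) hderiv
      (hint.sub hint') (tendsto_rpow_mul_expRemainder_succ (by linarith))
    rw [integral_sub hint hint', integral_const_mul, ih (by linarith) (by linarith),
      Real.Gamma_add_one hz.ne, expRemainder_succ_zero, mul_zero, sub_zero, ← mul_sub,
      mul_eq_zero, sub_eq_zero] at hzero
    exact hzero.resolve_left hz.ne

end ExpRemainder

section Subordination

theorem integral_Ioi_rpow_mul_comp_inv (g : ℝ → ℝ) (s : ℝ) :
    ∫ t in Ioi (0 : ℝ), t ^ (s - 1) * g t⁻¹ = ∫ u in Ioi (0 : ℝ), u ^ (-s - 1) * g u := by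
  rw [← integral_comp_rpow_Ioi (fun u => u ^ (-s - 1) * g u) (by norm_num : (-1 : ℝ) ≠ 0)]
  refine setIntegral_congr_fun measurableSet_Ioi fun t ht => ?_
  have ht' : (0 : ℝ) < t := ht
  simp only [abs_neg, abs_one, one_mul, smul_eq_mul, ← mul_assoc]
  rw [← Real.rpow_mul ht'.le, ← Real.rpow_add ht', Real.rpow_neg_one]
  ring_nf

theorem integral_rpow_mul_expRemainder_mul {p : ℕ} {z b : ℝ} (h0 : -p < z) (h1 : z < 1 - p)
    (hb : 0 < b) :
    ∫ u in Ioi (0 : ℝ), u ^ (z - 1) * expRemainder p (b * u) = b ^ (-z) * Real.Gamma z := by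
  have h := integral_comp_mul_left_Ioi (fun u => u ^ (z - 1) * expRemainder p u) 0 hb
  rw [mul_zero, integral_rpow_mul_expRemainder h0 h1, smul_eq_mul] at h
  have hsplit : ∫ u in Ioi (0 : ℝ), (b * u) ^ (z - 1) * expRemainder p (b * u) =
      b ^ (z - 1) * ∫ u in Ioi (0 : ℝ), u ^ (z - 1) * expRemainder p (b * u) := by
    rw [← integral_const_mul]
    refine setIntegral_congr_fun measurableSet_Ioi fun u hu => ?_
    simp only [Real.mul_rpow hb.le (mem_Ioi.1 hu).le, mul_assoc]
  rw [hsplit, Real.rpow_sub_one hb.ne'] at h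
  rw [Real.rpow_neg hb.le]
  field_simp at h ⊢
  linarith

theorem integral_rpow_mul_expRemainder_div {p : ℕ} {s b : ℝ} (h0 : p - 1 < s) (h1 : s < p)
    (hb : 0 < b) :
    ∫ t in Ioi (0 : ℝ), t ^ (s - 1) * expRemainder p (b * t⁻¹) = b ^ s * Real.Gamma (-s) := by
  rw [integral_Ioi_rpow_mul_comp_inv (fun u => expRemainder p (b * u)) s,
    integral_rpow_mul_expRemainder_mul (by linarith) (by linarith) hb, neg_neg]

theorem neg_one_pow_mul_Gamma_half_sub (p : ℕ) :
    (-1) ^ p * Real.Gamma (1 / 2 - p) =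
      2 ^ p * √Real.pi / (Nat.doubleFactorial (2 * p - 1) : ℝ) := by
  have hsin : Real.sin (Real.pi * (p + 1 / 2)) = (-1) ^ p := by
    rw [mul_add, mul_one_div, Real.sin_add_pi_div_two, mul_comm, Real.cos_nat_mul_pi]
  have hrefl := Real.Gamma_mul_Gamma_one_sub (p + 1 / 2)
  rw [hsin, Real.Gamma_nat_add_half, show 1 - ((p : ℝ) + 1 / 2) = 1 / 2 - p by ring] at hrefl
  have hdouble : (Nat.doubleFactorial (2 * p - 1) : ℝ) ≠ 0 := by
    exact_mod_cast (Nat.doubleFactorial_pos _).ne'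
  have hsq : √Real.pi * √Real.pi = Real.pi := Real.mul_self_sqrt Real.pi_pos.le
  have hpi : √Real.pi ≠ 0 := (Real.sqrt_pos.2 Real.pi_pos).ne'
  generalize Real.Gamma (1 / 2 - p) = γ at hrefl ⊢
  rw [eq_div_iff hdouble]
  refine mul_left_cancel₀ hpi ?_
  field_simp at hrefl
  linear_combination hrefl - 2 ^ p * hsq

theorem integral_integral_kernel_mul {α β : Type*} [MeasurableSpace α] [MeasurableSpace β]
    {μ : Measure α} {ν : Measure β} [SFinite μ] [SFinite ν] {k : α → β → ℝ} {K : α → ℝ}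
    {g : α → ℂ} (hk : Measurable (Function.uncurry k)) (hk0 : ∀ x, ∀ᵐ t ∂ν, 0 ≤ k x t)
    (hK : ∀ᵐ x ∂μ, 0 < K x ∧ ∫ t, k x t ∂ν = K x) (hg : AEStronglyMeasurable g μ)
    (hKg : Integrable (fun x => (K x : ℂ) * g x) μ) :
    ∫ t, ∫ x, (k x t : ℂ) * g x ∂μ ∂ν = ∫ x, (K x : ℂ) * g x ∂μ := by
  have hint : Integrable (Function.uncurry fun x t => (k x t : ℂ) * g x) (μ.prod ν) := by
    have hmeas : AEStronglyMeasurable (Function.uncurry fun x t => (k x t : ℂ) * g x) (μ.prod ν) :=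
      (Complex.measurable_ofReal.comp hk).aestronglyMeasurable.mul hg.comp_fst
    rw [integrable_prod_iff hmeas]
    refine ⟨hK.mono fun x hx => ?_, hKg.norm.congr (hK.mono fun x hx => ?_)⟩
    · have hkx : Integrable (k x) ν := .of_integral_ne_zero (hx.2.trans_ne hx.1.ne')
      exact (hkx.ofReal (𝕜 := ℂ)).mul_const (g x)
    · have hnorm : ∫ t, ‖(k x t : ℂ) * g x‖ ∂ν = ∫ t, k x t * ‖g x‖ ∂ν :=
        integral_congr_ae ((hk0 x).mono fun t ht => by simp [abs_of_nonneg ht])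
      simp only [Function.uncurry_apply_pair]
      rw [hnorm, integral_mul_const, hx.2, norm_mul, Complex.norm_real,
        Real.norm_of_nonneg hx.1.le]
  rw [← integral_integral_swap hint]
  refine integral_congr_ae (hK.mono fun x hx => ?_)
  simp only [integral_mul_const]
  rw [integral_complex_ofReal, hx.2]

/-- The smooth functions all of whose partial derivatives of order `d` vanish, that is, the
polynomials of degree less than `d`. -/
def HasDegreeLT : ℕ → (Euc n → ℂ) → Prop
  | 0, u => u = 0
  | d + 1, u => ContDiff ℝ ∞ u ∧ ∀ i, HasDegreeLT d (partialDeriv i u)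

namespace HasDegreeLT

variable {d : ℕ} {u v : Euc n → ℂ}

theorem contDiff (h : HasDegreeLT d u) : ContDiff ℝ ∞ u := by
  cases d with
  | zero => exact h ▸ contDiff_const
  | succ d => exact h.1

theorem zero (d : ℕ) : HasDegreeLT d (0 : Euc n → ℂ) := by
  induction d with
  | zero => rfl
  | succ d ih =>
    have hpartial (i : Fin n) : partialDeriv i (0 : Euc n → ℂ) = 0 :=
      funext (partialDeriv_const 0 i)
    exact ⟨contDiff_const, fun i => (hpartial i).symm ▸ ih⟩

theorem succ (h : HasDegreeLT d u) : HasDegreeLT (d + 1) u := by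
  induction d generalizing u with
  | zero => exact h ▸ zero 1
  | succ d ih => exact ⟨h.1, fun i => ih (h.2 i)⟩

theorem mono {d' : ℕ} (hd : d ≤ d') (h : HasDegreeLT d u) : HasDegreeLT d' u :=
  Nat.le_induction h (fun _ _ => succ) d' hd

theorem add (hu : HasDegreeLT d u) (hv : HasDegreeLT d v) : HasDegreeLT d (u + v) := by
  induction d generalizing u v with
  | zero => exact (congrArg₂ (· + ·) hu hv).trans (add_zero 0)
  | succ d ih =>
    refine ⟨hu.1.add hv.1, fun i => ?_⟩
    have hpartial : partialDeriv i (u + v) = partialDeriv i u + partialDeriv i v :=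
      funext fun y => by
        simp [partialDeriv, fderiv_add (hu.1.differentiable (by simp) y)
          (hv.1.differentiable (by simp) y)]
    exact hpartial ▸ ih (hu.2 i) (hv.2 i)

theorem sum {ι : Type*} {s : Finset ι} {u : ι → Euc n → ℂ} (h : ∀ j ∈ s, HasDegreeLT d (u j)) :
    HasDegreeLT d (∑ j ∈ s, u j) :=
  Finset.sum_induction u (HasDegreeLT d) (fun _ _ => add) (zero d) h

theorem const_mul (c : ℂ) (h : HasDegreeLT d u) : HasDegreeLT d (fun y => c * u y) := by
  induction d generalizing u with
  | zero => exact h ▸ funext fun _ => mul_zero c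
  | succ d ih =>
    refine ⟨contDiff_const.mul h.1, fun i => ?_⟩
    rw [funext fun y => partialDeriv_const_mul (h.1.differentiable (by simp) y) c i]
    exact ih (h.2 i)

theorem coord_mul (j : Fin n) (h : HasDegreeLT d u) :
    HasDegreeLT (d + 1) (fun y => ((y j : ℝ) : ℂ) * u y) := by
  induction d generalizing u with
  | zero =>
    have hzero : (fun y => ((y j : ℝ) : ℂ) * u y) = 0 := by
      rw [show u = 0 from h]
      exact funext fun _ => mul_zero _
    exact hzero ▸ zero 1
  | succ d ih =>
    refine ⟨(contDiff_coord j).mul h.1, fun i => ?_⟩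
    rw [funext fun y => partialDeriv_mul ((contDiff_coord j).differentiable (by simp) y)
      (h.1.differentiable (by simp) y) i]
    simp only [partialDeriv_coord, mul_comm (u _)]
    exact (ih (h.2 i)).add (h.const_mul _)

theorem norm_sq_pow (j : ℕ) :
    HasDegreeLT (2 * j + 1) (fun y : Euc n => (((‖y‖ ^ 2) ^ j : ℝ) : ℂ)) := by
  induction j with
  | zero =>
    simp only [pow_zero, Complex.ofReal_one]
    exact ⟨contDiff_const, fun i => funext (partialDeriv_const 1 i)⟩
  | succ j ih =>
    have hsum : (fun y : Euc n => (((‖y‖ ^ 2) ^ (j + 1) : ℝ) : ℂ)) =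
        ∑ l, fun y : Euc n =>
          ((y l : ℝ) : ℂ) * (((y l : ℝ) : ℂ) * (((‖y‖ ^ 2) ^ j : ℝ) : ℂ)) := by
      ext y
      simp only [Finset.sum_apply, ← mul_assoc, ← Finset.sum_mul, sum_coord_mul_coord, pow_succ']
      push_cast
      rfl
    exact hsum ▸ sum fun l _ => (ih.coord_mul l).coord_mul l

theorem iterDeriv_eq_zero {R : List (Fin n)} (h : HasDegreeLT R.length u) :
    iterDeriv R u = 0 := by
  have hmain (R : List (Fin n)) : ∀ d, HasDegreeLT (d + R.length) u →
      HasDegreeLT d (iterDeriv R u) := by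
    induction R with
    | nil => exact fun _ h => h
    | cons i R ih =>
      intro d h
      rw [List.length_cons, ← add_assoc, add_right_comm] at h
      exact (ih (d + 1) h).2 i
  exact hmain R 0 (by rwa [zero_add])

theorem integral_mul_iterDeriv {φ : Euc n → ℂ} {Ω : Set (Euc n)} {R : List (Fin n)}
    (h : HasDegreeLT R.length u) (hφ : IsTestOn Ω φ) : ∫ y, u y * iterDeriv R φ y = 0 := by
  have hmul := integral_iterDeriv_mul isOpen_univ h.contDiff.contDiffOn
    ⟨hφ.smooth, hφ.compact, subset_univ _⟩ R
  rw [h.iterDeriv_eq_zero] at hmul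
  simpa using hmul

end HasDegreeLT

theorem integral_gaussian_mul_iterDeriv {φ : Euc n → ℂ} {Ω : Set (Euc n)} (hφ : IsTestOn Ω φ)
    {R : List (Fin n)} {p : ℕ} (hR : R.length = 2 * p) (b : ℝ) :
    ∫ y, ((Real.exp (-b * ‖y‖ ^ 2) : ℝ) : ℂ) * iterDeriv R φ y =
      ∫ y, ((expRemainder p (b * ‖y‖ ^ 2) : ℝ) : ℂ) * iterDeriv R φ y := by
  have hpoly : HasDegreeLT R.length (∑ j ∈ Finset.range p, fun y : Euc n =>
      ((((-b) ^ j / (j.factorial : ℝ) : ℝ) : ℂ)) * (((‖y‖ ^ 2) ^ j : ℝ) : ℂ)) :=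
    .sum fun j hj => ((HasDegreeLT.norm_sq_pow j).const_mul _).mono (by
      have := Finset.mem_range.1 hj
      omega)
  have htest := hφ.iterDeriv R
  have hint := (IsTestOn.mk htest.smooth htest.compact (subset_univ _)).integrable_mul isOpen_univ
    (u := fun y => ((Real.exp (-b * ‖y‖ ^ 2) : ℝ) : ℂ)) (by fun_prop)
  have hint' := (IsTestOn.mk htest.smooth htest.compact (subset_univ _)).integrable_mul isOpen_univ
    hpoly.contDiff.continuous.continuousOn
  rw [← sub_zero (∫ y, _ * _), ← hpoly.integral_mul_iterDeriv hφ, ← integral_sub hint hint']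
  refine integral_congr_ae (Eventually.of_forall fun y => ?_)
  simp only [expRemainder, Finset.sum_apply, ← sub_mul]
  push_cast
  simp only [← neg_mul, mul_pow, mul_div_right_comm]

theorem integral_Ioi_rpow_mul_exp_neg_mul_norm_sq {p : ℕ} (ha : 0 < p + ((n : ℝ) - 1) / 2)
    {w : Euc n} (hw : w ≠ 0) :
    ∫ t in Ioi (0 : ℝ), t ^ (p + ((n : ℝ) - 1) / 2 - 1) * Real.exp (-(‖w‖ ^ 2 * t)) =
      Real.Gamma (p + ((n : ℝ) - 1) / 2) * ‖w‖ ^ (-((2 * p : ℕ) : ℤ) - n + 1) := by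
  have hw' : 0 < ‖w‖ := norm_pos_iff.2 hw
  rw [Real.integral_rpow_mul_exp_neg_mul_Ioi ha (by positivity), mul_comm, one_div,
    Real.inv_rpow (by positivity), ← Real.rpow_neg (by positivity), ← Real.rpow_natCast_mul hw'.le,
    ← Real.rpow_intCast]
  push_cast
  ring_nf

theorem integral_Ioi_rpow_mul_expRemainder_norm_sq (p : ℕ) {y : Euc n} (hy : y ≠ 0) :
    ∫ t in Ioi (0 : ℝ),
        (-1) ^ p * (t ^ ((p : ℝ) - 1 / 2 - 1) * expRemainder p (‖y‖ ^ 2 / 4 * t⁻¹)) =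
      2 ^ (1 - p : ℤ) * √Real.pi / (Nat.doubleFactorial (2 * p - 1) : ℝ) *
        ‖y‖ ^ (2 * (p : ℤ) - 1) := by
  have : 0 < ‖y‖ := norm_pos_iff.2 hy
  have hpow : (‖y‖ ^ 2 / 4) ^ ((p : ℝ) - 1 / 2) =
      2 ^ (1 - 2 * (p : ℤ)) * ‖y‖ ^ (2 * (p : ℤ) - 1) := by
    rw [show ‖y‖ ^ 2 / 4 = (‖y‖ / 2) ^ 2 by ring, ← Real.rpow_natCast_mul (by positivity),
      Nat.cast_ofNat, show 2 * ((p : ℝ) - 1 / 2) = ((2 * p - 1 : ℤ) : ℝ) by push_cast; ring,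
      Real.rpow_intCast, div_zpow, div_eq_inv_mul, ← zpow_neg, neg_sub]
  rw [integral_const_mul, integral_rpow_mul_expRemainder_div (by linarith) (by linarith)
    (by positivity), neg_sub, hpow, mul_left_comm, neg_one_pow_mul_Gamma_half_sub,
    show (1 - p : ℤ) = 1 - 2 * p + p by ring, zpow_add₀ two_ne_zero, zpow_natCast]
  ring

theorem ae_ne_zero [NeZero n] : ∀ᵐ w : Euc n, w ≠ 0 := compl_mem_ae_iff.2 (measure_singleton 0)

theorem integral_gaussian_mul_monomial_mul_fourier {q : 𝓢(Euc n, ℂ)} {Ω : Set (Euc n)}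
    (hq : IsTestOn Ω q) {R : List (Fin n)} {p : ℕ} (hR : R.length = 2 * p) {t : ℝ} (ht : 0 < t) :
    ∫ w, ((Real.exp (-t * ‖w‖ ^ 2) : ℝ) : ℂ) * (monomial R w * fourier n q w) =
      (((-1) ^ p * (2 * t) ^ (-(n : ℝ) / 2) : ℝ) : ℂ) *
        ∫ y, ((expRemainder p (‖y‖ ^ 2 / 4 * t⁻¹) : ℝ) : ℂ) * iterDeriv R q y := by
  have hsign : (-Complex.I) ^ R.length = (-1) ^ p := by
    rw [hR, pow_mul, neg_sq, Complex.I_sq]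
  simp only [monomial_mul_fourier, hsign, mul_left_comm _ ((-1 : ℂ) ^ p)]
  rw [integral_const_mul, integral_gaussian_mul_fourier ht, coe_schwartzDeriv,
    integral_gaussian_mul_iterDeriv hq hR]
  push_cast
  rw [mul_assoc]
  refine congrArg _ (congrArg _ (integral_congr_ae (Eventually.of_forall fun y => ?_)))
  beta_reduce
  rw [show (4 * t)⁻¹ * ‖y‖ ^ 2 = ‖y‖ ^ 2 / 4 * t⁻¹ by rw [mul_inv]; ring]

theorem gamma_mul_integral_rayKernel_mul [NeZero n] {p : ℕ} (ha : 0 < p + ((n : ℝ) - 1) / 2)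
    {R : List (Fin n)} (hR : R.length = 2 * p) (h : 𝓢(Euc n, ℂ)) :
    ((Real.Gamma (p + ((n : ℝ) - 1) / 2) : ℝ) : ℂ) * ∫ w, rayKernel R w * h w =
      ∫ t in Ioi (0 : ℝ), ((t ^ (p + ((n : ℝ) - 1) / 2 - 1) : ℝ) : ℂ) *
        ∫ w, ((Real.exp (-t * ‖w‖ ^ 2) : ℝ) : ℂ) * (monomial R w * h w) := by
  have := Real.Gamma_pos_of_pos ha
  have hkernel (w : Euc n) : ((Real.Gamma (p + ((n : ℝ) - 1) / 2) *
      ‖w‖ ^ (-((2 * p : ℕ) : ℤ) - n + 1) : ℝ) : ℂ) * (monomial R w * h w) =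
      (Real.Gamma (p + ((n : ℝ) - 1) / 2) : ℂ) * (rayKernel R w * h w) := by
    rw [rayKernel, normPow, hR]
    push_cast
    ring
  have hswap := integral_integral_kernel_mul (μ := volume) (ν := volume.restrict (Ioi 0))
    (k := fun (w : Euc n) t => t ^ (p + ((n : ℝ) - 1) / 2 - 1) * Real.exp (-(‖w‖ ^ 2 * t)))
    (g := fun w => monomial R w * h w) (by fun_prop)
    (fun w => (ae_restrict_mem measurableSet_Ioi).mono fun t ht => by
      have ht' : (0 : ℝ) < t := ht
      positivity)
    (ae_ne_zero.mono fun w hw => ⟨by positivity, integral_Ioi_rpow_mul_exp_neg_mul_norm_sq ha hw⟩)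
    ((continuous_monomial R).mul h.continuous).aestronglyMeasurable
    (by simpa only [hkernel] using (integrable_rayKernel_mul R h).const_mul _)
  simp only [hkernel, integral_const_mul] at hswap
  rw [← hswap]
  refine integral_congr_ae (Eventually.of_forall fun t => ?_)
  beta_reduce
  rw [← integral_const_mul]
  refine integral_congr_ae (Eventually.of_forall fun w => ?_)
  beta_reduce
  rw [neg_mul, mul_comm t]
  push_cast
  ring

theorem integral_Ioi_integral_expRemainder_mul [NeZero n] (p : ℕ) {φ : Euc n → ℂ}
    (hφ : IsTestOn {0}ᶜ φ) :
    ∫ t in Ioi (0 : ℝ), (((-1) ^ p * t ^ ((p : ℝ) - 1 / 2 - 1) : ℝ) : ℂ) *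
        ∫ y, ((expRemainder p (‖y‖ ^ 2 / 4 * t⁻¹) : ℝ) : ℂ) * φ y =
      ((2 ^ (1 - p : ℤ) * √Real.pi / (Nat.doubleFactorial (2 * p - 1) : ℝ) : ℝ) : ℂ) *
        ∫ y, normPow (2 * (p : ℤ) - 1) y * φ y := by
  have := Nat.doubleFactorial_pos (2 * p - 1)
  have hkernel (y : Euc n) : ((2 ^ (1 - p : ℤ) * √Real.pi /
      (Nat.doubleFactorial (2 * p - 1) : ℝ) * ‖y‖ ^ (2 * (p : ℤ) - 1) : ℝ) : ℂ) * φ y =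
      ((2 ^ (1 - p : ℤ) * √Real.pi / (Nat.doubleFactorial (2 * p - 1) : ℝ) : ℝ) : ℂ) *
        (normPow (2 * (p : ℤ) - 1) y * φ y) := by
    rw [normPow]
    push_cast
    ring
  have hmeas : Measurable (Function.uncurry fun (y : Euc n) (t : ℝ) =>
      (-1) ^ p * (t ^ ((p : ℝ) - 1 / 2 - 1) * expRemainder p (‖y‖ ^ 2 / 4 * t⁻¹))) := by
    have := (continuous_expRemainder p).measurable
    fun_prop
  have hswap := integral_integral_kernel_mul (μ := volume) (ν := volume.restrict (Ioi 0))
    (g := φ) hmeas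
    (fun y => (ae_restrict_mem measurableSet_Ioi).mono fun t ht => by
      have ht' : (0 : ℝ) < t := ht
      rw [mul_left_comm]
      exact mul_nonneg (by positivity)
        (neg_one_pow_mul_expRemainder_mem_Icc p (by positivity)).1)
    (ae_ne_zero.mono fun y hy => ⟨by positivity, integral_Ioi_rpow_mul_expRemainder_norm_sq p hy⟩)
    hφ.smooth.continuous.aestronglyMeasurable
    (by simpa only [hkernel] using
      (hφ.integrable_mul isOpen_compl_singleton (contDiffOn_normPow _).continuousOn).const_mul _)
  simp only [hkernel, integral_const_mul] at hswap
  rw [← hswap]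
  refine integral_congr_ae (Eventually.of_forall fun t => ?_)
  beta_reduce
  rw [← integral_const_mul]
  refine integral_congr_ae (Eventually.of_forall fun y => ?_)
  push_cast
  ring

/-- Up to the factor `Γ((2p + n - 1) / 2)`, the constant relating the Fourier transform of the ray
kernel to the derivatives of order `2p` of `|y|^{2p-1}`. -/
def subordinationConst (n p : ℕ) : ℝ :=
  2 ^ (-(n : ℝ) / 2) * (2 ^ (1 - p : ℤ) * √Real.pi / (Nat.doubleFactorial (2 * p - 1) : ℝ))

theorem gamma_mul_integral_rayKernel_mul_fourier [n.AtLeastTwo] {p : ℕ} {R : List (Fin n)}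
    (hR : R.length = 2 * p) {q : 𝓢(Euc n, ℂ)} (hq : IsTestOn {0}ᶜ q) :
    ((Real.Gamma (p + ((n : ℝ) - 1) / 2) : ℝ) : ℂ) * ∫ w, rayKernel R w * fourier n q w =
      (subordinationConst n p : ℂ) * ∫ y, iterDeriv R (normPow (2 * (p : ℤ) - 1)) y * q y := by
  have hn : (2 : ℝ) ≤ n := by exact_mod_cast Nat.AtLeastTwo.prop
  have ha : 0 < p + ((n : ℝ) - 1) / 2 := by
    have : (0 : ℝ) ≤ p := p.cast_nonneg
    linarith
  rw [gamma_mul_integral_rayKernel_mul ha hR, integral_iterDeriv_mul isOpen_compl_singleton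
    (contDiffOn_normPow _) hq, hR, pow_mul, neg_one_sq, one_pow, one_mul, subordinationConst,
    Complex.ofReal_mul, mul_assoc, ← integral_Ioi_integral_expRemainder_mul p (hq.iterDeriv R),
    ← integral_const_mul]
  refine setIntegral_congr_fun measurableSet_Ioi fun t ht => ?_
  have ht' : (0 : ℝ) < t := ht
  beta_reduce
  rw [integral_gaussian_mul_monomial_mul_fourier hq hR ht', ← mul_assoc, ← mul_assoc,
    ← Complex.ofReal_mul, ← Complex.ofReal_mul, Real.mul_rpow zero_le_two ht'.le,
    show (p : ℝ) - 1 / 2 - 1 = p + ((n : ℝ) - 1) / 2 - 1 + -(n : ℝ) / 2 by ring,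
    Real.rpow_add ht']
  congr 2
  ring

end Subordination

section RayConvolution

theorem inv_one_add_norm_add_sq_le {E : Type*} [SeminormedAddCommGroup E] (x w : E) :
    ((1 + ‖x + w‖) ^ 2)⁻¹ ≤ (1 + ‖x‖) ^ 2 * ((1 + ‖w‖) ^ 2)⁻¹ := by
  have htri : ‖w‖ ≤ ‖x + w‖ + ‖x‖ := by simpa using norm_sub_le (x + w) x
  rw [← div_eq_mul_inv, le_div_iff₀ (by positivity), inv_mul_le_iff₀ (by positivity), ← mul_pow]
  refine pow_le_pow_left₀ (by positivity) ?_ 2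
  nlinarith [norm_nonneg x, norm_nonneg (x + w)]

theorem exists_norm_add_le_mul_inv_one_add_sq (h : 𝓢(Euc n, ℂ)) :
    ∃ C, ∀ x w, ‖h (x + w)‖ ≤ C * (1 + ‖x‖) ^ 2 * ((1 + ‖w‖) ^ 2)⁻¹ := by
  obtain ⟨C, hC⟩ := exists_norm_le_mul_inv_one_add_sq h
  have hC0 : 0 ≤ C := by simpa using (norm_nonneg _).trans (hC 0)
  refine ⟨C, fun x w => (hC _).trans ?_⟩
  rw [mul_assoc]
  exact mul_le_mul_of_nonneg_left (inv_one_add_norm_add_sq_le x w) hC0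

/-- The convolution `2 ∫ w_R |w|^{-|R|-n+1} h(x + w) dw` of `h` with the kernel `rayKernel R`. -/
def rayConv (R : List (Fin n)) (h : 𝓢(Euc n, ℂ)) (x : Euc n) : ℂ :=
  2 * ∫ w, rayKernel R w * h (x + w)

theorem measurable_rayKernel_mul_add (R : List (Fin n)) (h : 𝓢(Euc n, ℂ)) :
    Measurable (fun z : Euc n × Euc n => rayKernel R z.2 * h (z.1 + z.2)) :=
  ((measurable_rayKernel R).comp measurable_snd).mul
    (h.continuous.measurable.comp (measurable_fst.add measurable_snd))

theorem stronglyMeasurable_rayConv (R : List (Fin n)) (h : 𝓢(Euc n, ℂ)) :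
    StronglyMeasurable (rayConv R h) :=
  ((measurable_rayKernel_mul_add R h).stronglyMeasurable.integral_prod_right
    (ν := volume)).const_mul 2

theorem exists_norm_rayConv_le [NeZero n] (R : List (Fin n)) (h : 𝓢(Euc n, ℂ)) :
    ∃ C, ∀ x, ‖rayConv R h x‖ ≤ C * (1 + ‖x‖) ^ 2 := by
  obtain ⟨C, hC⟩ := exists_norm_add_le_mul_inv_one_add_sq h
  refine ⟨2 * (C * ∫ w : Euc n, rayWeight w), fun x => ?_⟩
  calc ‖rayConv R h x‖ ≤ 2 * ∫ w : Euc n, C * (1 + ‖x‖) ^ 2 * rayWeight w := by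
        rw [rayConv, norm_mul, Complex.norm_ofNat]
        exact mul_le_mul_of_nonneg_left
          (norm_integral_le_of_norm_le (integrable_rayWeight.const_mul _)
            (Eventually.of_forall fun w =>
              norm_rayKernel_mul_le R (h := fun w => h (x + w)) (hC x w))) zero_le_two
    _ = 2 * (C * ∫ w : Euc n, rayWeight w) * (1 + ‖x‖) ^ 2 := by
        rw [integral_const_mul]
        ring

theorem integrable_one_add_norm_pow_mul (N : ℕ) (g : 𝓢(Euc n, ℂ)) :
    Integrable (fun x => (1 + ‖x‖) ^ N * ‖g x‖) := by
  simp only [add_comm (1 : ℝ), add_pow, one_pow, mul_one, Finset.sum_mul, mul_right_comm _ _ ‖g _‖]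
  exact integrable_finsetSum _ fun j _ => (g.integrable_pow_mul volume j).mul_const _

theorem integrable_rayKernel_mul_add_mul [NeZero n] (R : List (Fin n)) (h g : 𝓢(Euc n, ℂ)) :
    Integrable (fun z : Euc n × Euc n => rayKernel R z.2 * h (z.1 + z.2) * g z.1)
      (volume.prod volume) := by
  obtain ⟨C, hC⟩ := exists_norm_add_le_mul_inv_one_add_sq h
  refine (((integrable_one_add_norm_pow_mul 2 g).mul_prod integrable_rayWeight).const_mul C).mono'
    ((measurable_rayKernel_mul_add R h).mul
      (g.continuous.measurable.comp measurable_fst)).aestronglyMeasurable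
    (Eventually.of_forall fun z => ?_)
  calc ‖rayKernel R z.2 * h (z.1 + z.2) * g z.1‖
      ≤ C * (1 + ‖z.1‖) ^ 2 * rayWeight z.2 * ‖g z.1‖ := by
        rw [norm_mul]
        exact mul_le_mul_of_nonneg_right
          (norm_rayKernel_mul_le R (h := fun w => h (z.1 + w)) (hC z.1 z.2)) (norm_nonneg _)
    _ = C * ((1 + ‖z.1‖) ^ 2 * ‖g z.1‖ * rayWeight z.2) := by ring

theorem integral_comp_add_right_mul_fourier (h ψ : 𝓢(Euc n, ℂ)) (w : Euc n) :
    ∫ x, h (x + w) * fourier n ψ x = (((2 * Real.pi) ^ ((n : ℝ) / 2) : ℝ) : ℂ) *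
      fourier n (SchwartzMap.pairing (ContinuousLinearMap.mul ℂ ℂ) (fourier n h) ψ) (-w) := by
  rw [← fourierFun_coe ψ, integral_mul_fourierFun (h.integrable.comp_add_right w) ψ.integrable,
    fourier_apply, ← mul_assoc, ← Complex.ofReal_mul, ← Real.rpow_add Real.two_pi_pos, neg_div,
    add_neg_cancel, Real.rpow_zero, Complex.ofReal_one, one_mul]
  simp only [fourierFun_comp_add_right, fourierFun_coe, SchwartzMap.pairing_apply_apply,
    ContinuousLinearMap.mul_apply', inner_neg_left, real_inner_comm w, Complex.ofReal_neg,
    neg_mul_neg, mul_assoc]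

theorem integral_rayConv_mul_fourier_eq_integral_rayKernel [NeZero n] {R : List (Fin n)}
    (hR : Even R.length) (h ψ : 𝓢(Euc n, ℂ)) :
    ∫ x, rayConv R h x * fourier n ψ x = 2 * (((2 * Real.pi) ^ ((n : ℝ) / 2) : ℝ) : ℂ) *
      ∫ w, rayKernel R w *
        fourier n (SchwartzMap.pairing (ContinuousLinearMap.mul ℂ ℂ) (fourier n h) ψ) w := by
  set q := SchwartzMap.pairing (ContinuousLinearMap.mul ℂ ℂ) (fourier n h) ψ with hq
  calc ∫ x, rayConv R h x * fourier n ψ x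
      = 2 * ∫ x, ∫ w, rayKernel R w * h (x + w) * fourier n ψ x := by
        simp only [rayConv, mul_assoc, integral_const_mul, ← integral_mul_const]
    _ = 2 * ∫ w, rayKernel R w * ∫ x, h (x + w) * fourier n ψ x := by
        rw [integral_integral_swap (integrable_rayKernel_mul_add_mul R h (fourier n ψ))]
        simp only [mul_assoc, integral_const_mul]
    _ = 2 * (((2 * Real.pi) ^ ((n : ℝ) / 2) : ℝ) : ℂ) *
          ∫ w, rayKernel R (-w) * fourier n q (-w) := by
        simp only [integral_comp_add_right_mul_fourier, ← hq, rayKernel_neg hR,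
          mul_left_comm (rayKernel R _), integral_const_mul, mul_assoc]
    _ = _ := by rw [integral_neg_eq_self fun w => rayKernel R w * fourier n q w]

/-- The constant relating the convolution with `w_R |w|^{-2p-n+1}`, where `|R| = 2p`, and the
Fourier multiplier `∂_R |y|^{2p-1}`. For `p = m` it is the inverse of the constant in the
definition of `F^{(m,k)}`, up to `k!`. -/
def normalConst (n p : ℕ) : ℝ :=
  ((2 : ℝ) ^ ((p : ℤ) - 2) * (Nat.doubleFactorial (2 * p - 1) : ℝ) *
    Real.Gamma ((2 * (p : ℝ) + (n : ℝ) - 1) / 2) / Real.pi ^ (((n : ℝ) + 1) / 2))⁻¹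

theorem Gamma_pos_of_atLeastTwo [hn : n.AtLeastTwo] (p : ℕ) :
    0 < Real.Gamma ((2 * (p : ℝ) + (n : ℝ) - 1) / 2) := by
  have h2 : (2 : ℝ) ≤ n := by exact_mod_cast hn.prop
  exact Real.Gamma_pos_of_pos (by linarith [p.cast_nonneg (α := ℝ)])

theorem normalConst_ne_zero [n.AtLeastTwo] (p : ℕ) : normalConst n p ≠ 0 := by
  have hG := Gamma_pos_of_atLeastTwo (n := n) p
  have : (0 : ℝ) < Nat.doubleFactorial (2 * p - 1) := by
    exact_mod_cast Nat.doubleFactorial_pos _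
  unfold normalConst
  positivity

theorem two_mul_rpow_mul_subordinationConst [n.AtLeastTwo] (p : ℕ) :
    2 * (2 * Real.pi) ^ ((n : ℝ) / 2) * subordinationConst n p =
      normalConst n p * Real.Gamma ((p : ℝ) + ((n : ℝ) - 1) / 2) := by
  have hG := (Gamma_pos_of_atLeastTwo (n := n) p).ne'
  have hdf : (Nat.doubleFactorial (2 * p - 1) : ℝ) ≠ 0 := by
    exact_mod_cast (Nat.doubleFactorial_pos _).ne'
  have hpi : Real.pi ^ (((n : ℝ) + 1) / 2) = Real.pi ^ ((n : ℝ) / 2) * √Real.pi := by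
    rw [Real.sqrt_eq_rpow, ← Real.rpow_add Real.pi_pos, add_div]
  have htwo : (2 : ℝ) ^ (-(n : ℝ) / 2) = ((2 : ℝ) ^ ((n : ℝ) / 2))⁻¹ := by
    rw [neg_div, Real.rpow_neg zero_le_two]
  rw [show (p : ℝ) + ((n : ℝ) - 1) / 2 = (2 * (p : ℝ) + (n : ℝ) - 1) / 2 by ring, normalConst,
    subordinationConst, hpi, htwo, Real.mul_rpow zero_le_two Real.pi_pos.le,
    zpow_sub₀ two_ne_zero, zpow_sub₀ two_ne_zero]
  field_simp

theorem integral_rayConv_mul_fourier [n.AtLeastTwo] {p : ℕ} {R : List (Fin n)}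
    (hR : R.length = 2 * p) (h : 𝓢(Euc n, ℂ)) {ψ : 𝓢(Euc n, ℂ)} (hψ : IsTestOn {0}ᶜ ψ) :
    ∫ x, rayConv R h x * fourier n ψ x = (normalConst n p : ℂ) *
      ∫ y, iterDeriv R (normPow (2 * (p : ℤ) - 1)) y * (fourier n h y * ψ y) := by
  set q := SchwartzMap.pairing (ContinuousLinearMap.mul ℂ ℂ) (fourier n h) ψ with hqdef
  have hqc : ⇑q = fun y => fourier n h y * ψ y := by
    funext y
    simp [hqdef, SchwartzMap.pairing_apply_apply]
  have hsub : tsupport q ⊆ tsupport ψ := by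
    rw [hqc]
    exact tsupport_mul_subset_right
  have hq : IsTestOn {0}ᶜ q := ⟨q.smooth ⊤,
    hψ.compact.of_isClosed_subset (isClosed_tsupport _) hsub, hsub.trans hψ.tsupport_subset⟩
  have hG : (Real.Gamma ((p : ℝ) + ((n : ℝ) - 1) / 2) : ℂ) ≠ 0 := by
    have := (Gamma_pos_of_atLeastTwo (n := n) p).ne'
    rw [show (2 * (p : ℝ) + (n : ℝ) - 1) / 2 = (p : ℝ) + ((n : ℝ) - 1) / 2 by ring] at this
    exact_mod_cast this
  have hsubord := gamma_mul_integral_rayKernel_mul_fourier hR hq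
  have hconst : (2 : ℂ) * (((2 * Real.pi) ^ ((n : ℝ) / 2) : ℝ) : ℂ) * (subordinationConst n p : ℂ) =
      (normalConst n p : ℂ) * (Real.Gamma ((p : ℝ) + ((n : ℝ) - 1) / 2) : ℂ) := by
    exact_mod_cast congrArg (fun t : ℝ => (t : ℂ)) (two_mul_rpow_mul_subordinationConst p)
  rw [integral_rayConv_mul_fourier_eq_integral_rayKernel ⟨p, by omega⟩, ← hqdef]
  refine mul_left_cancel₀ hG ?_
  rw [hqc] at hsubord
  linear_combination (2 * (((2 * Real.pi) ^ ((n : ℝ) / 2) : ℝ) : ℂ)) * hsubord +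
    (∫ y, iterDeriv R (normPow (2 * (p : ℤ) - 1)) y * (fourier n h y * ψ y)) * hconst

end RayConvolution

section TemperedFunctions

variable {u : Euc n → ℂ} {C : ℝ} {N : ℕ}

theorem integrable_mul_of_growth (hu : AEStronglyMeasurable u volume)
    (hC : ∀ x, ‖u x‖ ≤ C * (1 + ‖x‖) ^ N) (φ : 𝓢(Euc n, ℂ)) :
    Integrable (fun x => u x * φ x) := by
  refine ((integrable_one_add_norm_pow_mul N φ).const_mul C).mono'
    (hu.mul φ.continuous.aestronglyMeasurable) (Eventually.of_forall fun x => ?_)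
  rw [norm_mul, ← mul_assoc]
  exact mul_le_mul_of_nonneg_right (hC x) (norm_nonneg _)

theorem norm_mul_le_seminorm_mul (hC : ∀ x, ‖u x‖ ≤ C * (1 + ‖x‖) ^ N) (d : ℕ)
    (φ : 𝓢(Euc n, ℂ)) (x : Euc n) :
    ‖u x * φ x‖ ≤ C * (2 ^ (N + d) *
      (Finset.Iic (N + d, 0)).sup (schwartzSeminormFamily ℂ (Euc n) ℂ) φ) *
        (1 + ‖x‖) ^ (-(d : ℝ)) := by
  have hC0 : 0 ≤ C := by simpa using (norm_nonneg _).trans (hC 0)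
  have hφ : (1 + ‖x‖) ^ (N + d) * ‖φ x‖ ≤ 2 ^ (N + d) *
      (Finset.Iic (N + d, 0)).sup (schwartzSeminormFamily ℂ (Euc n) ℂ) φ := by
    have := SchwartzMap.one_add_le_sup_seminorm_apply (𝕜 := ℂ) (m := (N + d, 0))
      (k := N + d) (n := 0) le_rfl le_rfl φ x
    rwa [norm_iteratedFDeriv_zero] at this
  rw [norm_mul, Real.rpow_neg (by positivity), Real.rpow_natCast, ← div_eq_mul_inv,
    le_div_iff₀ (by positivity)]
  calc ‖u x‖ * ‖φ x‖ * (1 + ‖x‖) ^ d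
      ≤ C * (1 + ‖x‖) ^ N * ‖φ x‖ * (1 + ‖x‖) ^ d := by
        gcongr
        exact hC x
    _ = C * ((1 + ‖x‖) ^ (N + d) * ‖φ x‖) := by
        rw [pow_add]
        ring
    _ ≤ _ := mul_le_mul_of_nonneg_left hφ hC0

theorem exists_isDefinedBy_of_growth (hu : AEStronglyMeasurable u volume)
    (hC : ∀ x, ‖u x‖ ≤ C * (1 + ‖x‖) ^ N) : ∃ U : 𝓢'(Euc n, ℂ), IsDefinedBy U u := by
  have hC0 : 0 ≤ C := by simpa using (norm_nonneg _).trans (hC 0)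
  have hint := integrable_mul_of_growth hu hC
  obtain ⟨d, hd⟩ :=
    (inferInstance : (volume : Measure (Euc n)).HasTemperateGrowth).exists_integrable
  let A : 𝓢(Euc n, ℂ) →L[ℂ] ℂ :=
    SchwartzMap.mkCLMtoNormedSpace (fun φ => ∫ x, u x * φ x)
      (fun φ ψ => by
        simp only [add_apply, mul_add]
        exact integral_add (hint φ) (hint ψ))
      (fun c φ => by
        simp only [smul_apply, smul_eq_mul, mul_left_comm _ c]
        exact integral_const_mul c _)
      ⟨Finset.Iic (N + d, 0), C * (2 ^ (N + d) * ∫ x : Euc n, (1 + ‖x‖) ^ (-(d : ℝ))),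
        by positivity, fun φ =>
          (norm_integral_le_of_norm_le (hd.const_mul _)
            (Eventually.of_forall (norm_mul_le_seminorm_mul hC d φ))).trans_eq (by
              rw [integral_const_mul]
              ring)⟩
  exact ⟨ContinuousLinearMap.toPointwiseConvergenceCLM _ _ _ _ A, fun φ => ⟨hint φ, rfl⟩⟩

end TemperedFunctions

section NormalOperator

variable {k : ℕ}

theorem inner_pow_eq_sum (k : ℕ) (x ξ : Euc n) :
    ((inner ℝ x ξ : ℝ) : ℂ) ^ k =
      ∑ K : Fin k → Fin n, monomial (List.ofFn K) x * monomial (List.ofFn K) ξ := by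
  have hinner : ((inner ℝ x ξ : ℝ) : ℂ) = ∑ l, ((x l : ℝ) : ℂ) * ((ξ l : ℝ) : ℂ) := by
    simp [PiLp.inner_apply, mul_comm]
  simp only [hinner, Fintype.sum_pow, monomial_ofFn, Finset.prod_mul_distrib]

theorem integrable_line_add (h : 𝓢(Euc n, ℂ)) (x : Euc n) {ξ : Euc n} (hξ : ‖ξ‖ = 1) :
    Integrable (fun s : ℝ => h (x + s • ξ)) := by
  simpa [add_comm] using integrable_line (SchwartzMap.compSubConstCLM ℂ (-x) h) hξ

/-- The parameter of the line through `x` is shifted so that `t` becomes `⟨x + sξ, ξ⟩`. -/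
theorem momentumRay_lineThrough (k : ℕ) (f : (Fin m → Fin n) → 𝓢(Euc n, ℂ)) (x : Euc n)
    (ξ : Metric.sphere (0 : Euc n) 1) :
    momentumRay k f (lineThrough x ξ) = ∑ b : (Fin m → Fin n) × (Fin k → Fin n),
      monomial (List.ofFn b.1 ++ List.ofFn b.2) (ξ : Euc n) *
        ∫ s : ℝ, schwartzMonomial (List.ofFn b.2) (f b.1) (x + s • (ξ : Euc n)) := by
  have hξ : ‖(ξ : Euc n)‖ = 1 := norm_eq_of_mem_sphere ξ
  have hpoint (s : ℝ) : x - (inner ℝ x (ξ : Euc n) : ℝ) • (ξ : Euc n) +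
      (s + inner ℝ x (ξ : Euc n)) • (ξ : Euc n) = x + s • (ξ : Euc n) := by
    rw [add_smul]
    abel
  have hparam (s : ℝ) : s + inner ℝ x (ξ : Euc n) = inner ℝ (x + s • (ξ : Euc n)) (ξ : Euc n) := by
    rw [inner_add_left, real_inner_smul_left, real_inner_self_eq_norm_sq, hξ]
    ring
  have hintegrand (s : ℝ) : ((s + inner ℝ x (ξ : Euc n) : ℝ) : ℂ) ^ k *
      ∑ i : Fin m → Fin n, f i (x + s • (ξ : Euc n)) * ∏ a, (((ξ : Euc n) (i a) : ℝ) : ℂ) =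
      ∑ b : (Fin m → Fin n) × (Fin k → Fin n),
        monomial (List.ofFn b.1 ++ List.ofFn b.2) (ξ : Euc n) *
          schwartzMonomial (List.ofFn b.2) (f b.1) (x + s • (ξ : Euc n)) := by
    rw [hparam, inner_pow_eq_sum, Finset.sum_mul_sum, Finset.sum_comm, Fintype.sum_prod_type]
    refine Finset.sum_congr rfl fun J _ => Finset.sum_congr rfl fun K _ => ?_
    rw [schwartzMonomial_apply, monomial_append, monomial_ofFn J]
    ring
  rw [momentumRay, ← integral_add_right_eq_self _ (inner ℝ x (ξ : Euc n))]
  simp only [lineThrough, hpoint, hintegrand]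
  rw [integral_finsetSum _ fun b _ => (integrable_line_add _ x hξ).const_mul _]
  simp only [integral_const_mul]

/-- The indices `(K, J, K')` of the expansion of `N_m^k f` into convolutions: `K` comes from
`⟨x, ξ⟩^k`, `J` from the components of `f`, and `K'` from `t^k`. -/
abbrev NormalIndex (n m k : ℕ) : Type := (Fin k → Fin n) × (Fin m → Fin n) × (Fin k → Fin n)

/-- The concatenation of `K`, `i`, `J` and `K'`, for `a = (K, J, K')`. -/
def normalWord (i : Fin m → Fin n) (a : NormalIndex n m k) : List (Fin n) :=
  List.ofFn a.1 ++ List.ofFn i ++ (List.ofFn a.2.1 ++ List.ofFn a.2.2)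

theorem length_normalWord (i : Fin m → Fin n) (a : NormalIndex n m k) :
    (normalWord i a).length = 2 * (m + k) := by
  simp only [normalWord, List.length_append, List.length_ofFn]
  ring

/-- The term of index `(K, J, K')` of the expansion of `(N_m^k f)_i` into convolutions. -/
def normalTerm (f : (Fin m → Fin n) → 𝓢(Euc n, ℂ)) (i : Fin m → Fin n) (a : NormalIndex n m k)
    (x : Euc n) : ℂ :=
  monomial (List.ofFn a.1) x *
    rayConv (normalWord i a) (schwartzMonomial (List.ofFn a.2.2) (f a.2.1)) x

theorem stronglyMeasurable_normalTerm (f : (Fin m → Fin n) → 𝓢(Euc n, ℂ)) (i : Fin m → Fin n)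
    (a : NormalIndex n m k) : StronglyMeasurable (normalTerm f i a) :=
  (continuous_monomial _).stronglyMeasurable.mul (stronglyMeasurable_rayConv _ _)

theorem integral_normalTerm_mul_fourier [n.AtLeastTwo] (f : (Fin m → Fin n) → 𝓢(Euc n, ℂ))
    (i : Fin m → Fin n) (a : NormalIndex n m k) {φ : 𝓢(Euc n, ℂ)} (hφ : IsTestOn {0}ᶜ φ) :
    ∫ x, normalTerm f i a x * fourier n φ x = (normalConst n (m + k) : ℂ) *
      ∫ y, iterDeriv (normalWord i a) (normPow (2 * ((m + k : ℕ) : ℤ) - 1)) y *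
        (iterDeriv (List.ofFn a.2.2) (fourier n (f a.2.1)) y * iterDeriv (List.ofFn a.1) φ y) := by
  have htest : IsTestOn {0}ᶜ (schwartzDeriv (List.ofFn a.1) φ) := by
    rw [coe_schwartzDeriv]
    exact hφ.iterDeriv _
  have hI : (-Complex.I) ^ k * Complex.I ^ k = 1 := by
    rw [← mul_pow]
    simp
  have hmon (x : Euc n) : normalTerm f i a x * fourier n φ x = (-Complex.I) ^ k *
      (rayConv (normalWord i a) (schwartzMonomial (List.ofFn a.2.2) (f a.2.1)) x *
        fourier n (schwartzDeriv (List.ofFn a.1) φ) x) := by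
    have := monomial_mul_fourier (List.ofFn a.1) φ x
    rw [List.length_ofFn] at this
    rw [normalTerm]
    linear_combination
      rayConv (normalWord i a) (schwartzMonomial (List.ofFn a.2.2) (f a.2.1)) x * this
  simp only [hmon]
  rw [integral_const_mul, integral_rayConv_mul_fourier (length_normalWord i a) _ htest,
    mul_left_comm, ← integral_const_mul]
  simp only [fourier_schwartzMonomial, coe_schwartzDeriv, List.length_ofFn]
  congr 2 with y
  linear_combination (iterDeriv (normalWord i a) (normPow (2 * ((m + k : ℕ) : ℤ) - 1)) y *
    (iterDeriv (List.ofFn a.2.2) (fourier n (f a.2.1)) y * iterDeriv (List.ofFn a.1) φ y)) * hI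

variable [NeZero n]

theorem integrable_sphere_line_add {R : List (Fin n)} (hR : Even R.length) (h : 𝓢(Euc n, ℂ))
    (x : Euc n) :
    Integrable (fun ξ : Metric.sphere (0 : Euc n) 1 =>
      monomial R (ξ : Euc n) * ∫ s : ℝ, h (x + s • (ξ : Euc n)))
      (volume : Measure (Euc n)).toSphere := by
  simpa [add_comm] using integrable_sphere_line hR (SchwartzMap.compSubConstCLM ℂ (-x) h)

theorem integral_sphere_line_add {R : List (Fin n)} (hR : Even R.length) (h : 𝓢(Euc n, ℂ))
    (x : Euc n) :
    ∫ ξ : Metric.sphere (0 : Euc n) 1,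
      monomial R (ξ : Euc n) * (∫ s : ℝ, h (x + s • (ξ : Euc n)))
      ∂(volume : Measure (Euc n)).toSphere = rayConv R h x := by
  simpa [add_comm, rayConv] using integral_sphere_line hR (SchwartzMap.compSubConstCLM ℂ (-x) h)

theorem normalOp_eq_sum (k : ℕ) (f : (Fin m → Fin n) → 𝓢(Euc n, ℂ)) (x : Euc n)
    (i : Fin m → Fin n) :
    normalOp k f x i = ∑ a : NormalIndex n m k, normalTerm f i a x := by
  have heven (a : NormalIndex n m k) : Even (normalWord i a).length :=
    ⟨m + k, by rw [length_normalWord, two_mul]⟩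
  have hintegrand (ξ : Metric.sphere (0 : Euc n) 1) :
      ((inner ℝ x (ξ : Euc n) : ℝ) : ℂ) ^ k * (∏ a, (((ξ : Euc n) (i a) : ℝ) : ℂ)) *
        momentumRay k f (lineThrough x ξ) =
      ∑ a : NormalIndex n m k, monomial (List.ofFn a.1) x *
        (monomial (normalWord i a) (ξ : Euc n) *
          ∫ s : ℝ, schwartzMonomial (List.ofFn a.2.2) (f a.2.1) (x + s • (ξ : Euc n))) := by
    rw [momentumRay_lineThrough, inner_pow_eq_sum, Finset.sum_mul, Finset.sum_mul_sum,
      Fintype.sum_prod_type]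
    refine Finset.sum_congr rfl fun K _ => Finset.sum_congr rfl fun b _ => ?_
    rw [normalWord, monomial_append (_ ++ _), monomial_append (List.ofFn K) (List.ofFn i),
      monomial_ofFn i]
    ring
  rw [normalOp, momentumRayAdjoint]
  simp only [hintegrand]
  rw [integral_finsetSum _ fun a _ => (integrable_sphere_line_add (heven a) _ x).const_mul _]
  simp only [integral_const_mul, integral_sphere_line_add (heven _), normalTerm]

theorem exists_norm_normalTerm_le (f : (Fin m → Fin n) → 𝓢(Euc n, ℂ)) (i : Fin m → Fin n)
    (a : NormalIndex n m k) : ∃ C, ∀ x, ‖normalTerm f i a x‖ ≤ C * (1 + ‖x‖) ^ (k + 2) := by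
  obtain ⟨C, hC⟩ :=
    exists_norm_rayConv_le (normalWord i a) (schwartzMonomial (List.ofFn a.2.2) (f a.2.1))
  refine ⟨C, fun x => ?_⟩
  have hmon : ‖monomial (List.ofFn a.1) x‖ ≤ (1 + ‖x‖) ^ k := by
    have hle := norm_monomial_le (List.ofFn a.1) x
    rw [List.length_ofFn] at hle
    exact hle.trans (pow_le_pow_left₀ (norm_nonneg _) (by linarith) _)
  rw [normalTerm, norm_mul, pow_add, mul_left_comm]
  exact mul_le_mul hmon (hC x) (norm_nonneg _) (by positivity)

theorem exists_isDefinedBy_normalOp (k : ℕ) (f : (Fin m → Fin n) → 𝓢(Euc n, ℂ))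
    (i : Fin m → Fin n) : ∃ U : 𝓢'(Euc n, ℂ), IsDefinedBy U (fun x => normalOp k f x i) := by
  choose C hC using exists_norm_normalTerm_le (k := k) f i
  simp only [normalOp_eq_sum]
  refine exists_isDefinedBy_of_growth (N := k + 2) (C := ∑ a, C a)
    (Finset.stronglyMeasurable_fun_sum _ fun a _ =>
      stronglyMeasurable_normalTerm f i a).aestronglyMeasurable fun x => ?_
  rw [Finset.sum_mul]
  exact (norm_sum_le _ _).trans (Finset.sum_le_sum fun a _ => hC a x)

theorem integrable_normalTerm_mul (f : (Fin m → Fin n) → 𝓢(Euc n, ℂ)) (i : Fin m → Fin n)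
    (a : NormalIndex n m k) (φ : 𝓢(Euc n, ℂ)) : Integrable (fun x => normalTerm f i a x * φ x) :=
  let ⟨_, hC⟩ := exists_norm_normalTerm_le f i a
  integrable_mul_of_growth (stronglyMeasurable_normalTerm f i a).aestronglyMeasurable hC φ

end NormalOperator

section Symbol

variable {F : (Fin m → Fin n) → Euc n → ℂ} {y : Euc n}

theorem doubleFactorial_two_mul_add_one_sub_one (p : ℕ) :
    Nat.doubleFactorial (2 * (p + 1) - 1) = (2 * p + 1) * Nat.doubleFactorial (2 * p - 1) := by
  rw [show 2 * (p + 1) - 1 = 2 * p + 1 by omega, Nat.doubleFactorial_add_one]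

theorem normalConst_succ [hn : n.AtLeastTwo] (p : ℕ) :
    normalConst n (p + 1) * ((2 * p + 1) * (2 * p + n - 1)) = normalConst n p := by
  have hG := (Gamma_pos_of_atLeastTwo (n := n) p).ne'
  have hdf : (Nat.doubleFactorial (2 * p - 1) : ℝ) ≠ 0 := by
    exact_mod_cast (Nat.doubleFactorial_pos _).ne'
  have hfactor : 2 * (p : ℝ) + n - 1 ≠ 0 := by
    have h2 : (2 : ℝ) ≤ n := by exact_mod_cast hn.prop
    linarith [p.cast_nonneg (α := ℝ)]
  have hGamma : Real.Gamma ((2 * ((p + 1 : ℕ) : ℝ) + n - 1) / 2) =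
      (2 * (p : ℝ) + n - 1) / 2 * Real.Gamma ((2 * (p : ℝ) + n - 1) / 2) := by
    rw [← Real.Gamma_add_one (div_ne_zero hfactor two_ne_zero)]
    congr 1
    push_cast
    ring
  have hpow : (2 : ℝ) ^ (((p + 1 : ℕ) : ℤ) - 2) = 2 * 2 ^ ((p : ℤ) - 2) := by
    rw [Nat.cast_succ, add_sub_right_comm, zpow_add_one₀ two_ne_zero, mul_comm]
  rw [normalConst, normalConst, hGamma, doubleFactorial_two_mul_add_one_sub_one, hpow]
  push_cast
  field_simp

/-- The field `κ_p ∂_{X J K} |y|^{2p-1} ∂_K F_J`, summed over `J` and `K`, of rank `2p - m - k`,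
where `κ_p` is `normalConst n p`; its components of other ranks vanish. For `F = f̂` and
`p = m + k` its `k`-fold divergence is, up to sign, the Fourier transform of `N_m^k f`. -/
def symbolField (F : (Fin m → Fin n) → Euc n → ℂ) (k p : ℕ) : ListField n := fun X y =>
  if X.length + (m + k) = 2 * p then
    (normalConst n p : ℂ) * ∑ b : (Fin m → Fin n) × (Fin k → Fin n),
      iterDeriv (X ++ (List.ofFn b.1 ++ List.ofFn b.2)) (normPow (2 * (p : ℤ) - 1)) y *
        iterDeriv (List.ofFn b.2) (F b.1) y
  else 0

theorem isSmoothSymmOn_symbolField (hF : ∀ J, ContDiffOn ℝ ∞ (F J) {0}ᶜ) (k p : ℕ) :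
    (symbolField F k p).IsSmoothSymmOn {0}ᶜ where
  perm hR y hy := by
    have hperm (Y : List (Fin n)) :=
      iterDeriv_perm isOpen_compl_singleton (contDiffOn_normPow (2 * (p : ℤ) - 1))
        (hR.append_right Y) hy
    simp only [symbolField, hR.length_eq, hperm]
  smooth X := by
    change ContDiffOn ℝ ∞ (fun y => symbolField F k p X y) {0}ᶜ
    by_cases h : X.length + (m + k) = 2 * p
    · simp only [symbolField, if_pos h]
      exact contDiffOn_const.mul (ContDiffOn.sum fun b _ =>
        (contDiffOn_iterDeriv isOpen_compl_singleton (contDiffOn_normPow _) _).mul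
          (contDiffOn_iterDeriv isOpen_compl_singleton (hF b.1) _))
    · simp only [symbolField, if_neg h]
      exact contDiffOn_const

/-- The rank of `symbolField F k p` is such that the derivatives of `|y|^{2p-1}` contracted with
`y` are homogeneous of degree zero, and Euler's identity applies. -/
theorem contractPos_symbolField (F : (Fin m → Fin n) → Euc n → ℂ) (k p : ℕ) (X : List (Fin n))
    (hy : y ≠ 0) : contractPos (symbolField F k p) X y = 0 := by
  by_cases h : X.length + 1 + (m + k) = 2 * p
  · have hdegree (b : (Fin m → Fin n) × (Fin k → Fin n)) :
        (((2 * (p : ℤ) - 1 : ℤ) : ℂ) - (X ++ (List.ofFn b.1 ++ List.ofFn b.2)).length) = 0 := by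
      have hlen : (X ++ (List.ofFn b.1 ++ List.ofFn b.2)).length + 1 = 2 * p := by
        simp only [List.length_append, List.length_ofFn]
        omega
      have hlen' := congrArg (Nat.cast : ℕ → ℂ) hlen
      push_cast at hlen' ⊢
      linear_combination -hlen'
    calc contractPos (symbolField F k p) X y
        = (normalConst n p : ℂ) * ∑ b : (Fin m → Fin n) × (Fin k → Fin n),
            contractPos (iterDeriv · (normPow (2 * (p : ℤ) - 1)))
              (X ++ (List.ofFn b.1 ++ List.ofFn b.2)) y * iterDeriv (List.ofFn b.2) (F b.1) y := by
          simp only [contractPos, symbolField, List.length_cons, if_pos h, Finset.mul_sum,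
            Finset.sum_mul, List.cons_append]
          rw [Finset.sum_comm]
          exact Finset.sum_congr rfl fun b _ => Finset.sum_congr rfl fun l _ => by ring
      _ = 0 := by simp only [contractPos_iterDeriv_normPow _ _ hy, hdegree, zero_mul,
          Finset.sum_const_zero, mul_zero]
  · simp [contractPos, symbolField, h]

variable [n.AtLeastTwo]

theorem trace_symbolField (F : (Fin m → Fin n) → Euc n → ℂ) (k p : ℕ) (X : List (Fin n))
    (hy : y ≠ 0) : trace (symbolField F k (p + 1)) X y = symbolField F k p X y := by
  by_cases h : X.length + (m + k) = 2 * p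
  · have h' : X.length + 1 + 1 + (m + k) = 2 * (p + 1) := by omega
    calc trace (symbolField F k (p + 1)) X y
        = (normalConst n (p + 1) : ℂ) * ∑ b : (Fin m → Fin n) × (Fin k → Fin n),
            trace (iterDeriv · (normPow (2 * ((p + 1 : ℕ) : ℤ) - 1)))
              (X ++ (List.ofFn b.1 ++ List.ofFn b.2)) y * iterDeriv (List.ofFn b.2) (F b.1) y := by
          simp only [trace, symbolField, List.length_cons, if_pos h', Finset.mul_sum,
            Finset.sum_mul, List.cons_append]
          exact Finset.sum_comm
      _ = symbolField F k p X y := by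
          rw [symbolField, if_pos h, ← normalConst_succ p]
          simp only [trace_iterDeriv_normPow _ _ hy, Finset.mul_sum]
          rw [show 2 * ((p + 1 : ℕ) : ℤ) - 1 - 2 = 2 * p - 1 by push_cast; ring]
          refine Finset.sum_congr rfl fun b _ => ?_
          push_cast
          ring
  · have h' : ¬ X.length + 1 + 1 + (m + k) = 2 * (p + 1) := by omega
    simp [trace, symbolField, h, h']

theorem iterate_trace_symbolField (F : (Fin m → Fin n) → Euc n → ℂ) (k p j : ℕ)
    (X : List (Fin n)) (hy : y ≠ 0) :
    trace^[j] (symbolField F k (p + j)) X y = symbolField F k p X y := by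
  induction j generalizing p X with
  | zero => rfl
  | succ j ih =>
    have hj (X : List (Fin n)) :
        trace^[j] (symbolField F k (p + (j + 1))) X y = symbolField F k (p + 1) X y := by
      rw [← ih (p + 1) X, add_right_comm, add_assoc]
    rw [Function.iterate_succ_apply', ← trace_symbolField F k p X hy]
    exact Finset.sum_congr rfl fun l _ => hj _

end Symbol

section SymmetricTensors

variable {Ω : Set (Euc n)} {u : Euc n → Tensor n m} {T : List (Fin n) → ℂ} {y : Euc n}

theorem symmetrize_of_isSymm {v : Tensor n m} (hv : IsSymm v) : symmetrize v = v := by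
  funext i
  rw [symmetrize, Finset.sum_congr rfl fun π _ => hv π i, Finset.sum_const, Finset.card_univ,
    Fintype.card_perm, Fintype.card_fin, nsmul_eq_mul,
    inv_mul_cancel_left₀ (Nat.cast_ne_zero.2 m.factorial_ne_zero)]

theorem sum_mul_symmetrize (hT : ∀ {R R'}, R.Perm R' → T R = T R') (v : Tensor n m) :
    ∑ j, T (List.ofFn j) * symmetrize v j = ∑ j, T (List.ofFn j) * v j := by
  have hreindex (π : Equiv.Perm (Fin m)) :
      ∑ j : Fin m → Fin n, T (List.ofFn j) * v (j ∘ π) = ∑ j, T (List.ofFn j) * v j :=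
    Fintype.sum_equiv (Equiv.arrowCongr π.symm (Equiv.refl (Fin n))) _ _ fun j =>
      congrArg (· * v (j ∘ π)) (hT (Equiv.Perm.ofFn_comp_perm π j)).symm
  simp only [symmetrize, mul_left_comm _ ((m.factorial : ℂ))⁻¹]
  rw [← Finset.mul_sum]
  simp only [Finset.mul_sum _ (fun π : Equiv.Perm (Fin m) => v (_ ∘ π))]
  rw [Finset.sum_comm, Finset.sum_congr rfl fun π _ => hreindex π, Finset.sum_const,
    Finset.card_univ, Fintype.card_perm, Fintype.card_fin, nsmul_eq_mul,
    inv_mul_cancel_left₀ (Nat.cast_ne_zero.2 m.factorial_ne_zero)]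

theorem ofFn_comp_cast {α : Type*} {p q : ℕ} (h : p = q) (i : Fin q → α) :
    List.ofFn (i ∘ Fin.cast h) = List.ofFn i :=
  (List.ofFn_congr h.symm i).symm

theorem ofFn_snoc_perm {α : Type*} (j : Fin m → α) (l : α) :
    (List.ofFn (Fin.snoc (α := fun _ => α) j l)).Perm (l :: List.ofFn j) := by
  rw [List.ofFn_succ']
  simp only [Fin.snoc_castSucc, Fin.snoc_last, List.concat_eq_append]
  exact List.perm_append_singleton _ _

theorem sum_mul_innerDeriv (hT : ∀ {R R'}, R.Perm R' → T R = T R') (u : Euc n → Tensor n m)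
    (y : Euc n) :
    ∑ j, T (List.ofFn j) * innerDeriv u y j =
      ∑ l, ∑ j, T (l :: List.ofFn j) * partialDeriv l (fun z => u z j) y := by
  refine (sum_mul_symmetrize hT _).trans ?_
  rw [← (Fin.snocEquiv fun _ : Fin (m + 1) => Fin n).sum_comp, Fintype.sum_prod_type]
  refine Finset.sum_congr rfl fun l _ => Finset.sum_congr rfl fun j _ => ?_
  have hsnoc : (Fin.snocEquiv fun _ : Fin (m + 1) => Fin n) (l, j) =
      Fin.snoc (α := fun _ => Fin n) j l := rfl
  simp only [hsnoc, Fin.snoc_last, Fin.init_snoc, hT (ofFn_snoc_perm j l)]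

theorem contDiffOn_innerDerivPow (hΩ : IsOpen Ω) (hu : ∀ J, ContDiffOn ℝ ∞ (fun z => u z J) Ω)
    (k : ℕ) (j : Fin (m + k) → Fin n) : ContDiffOn ℝ ∞ (fun z => innerDerivPow k u z j) Ω := by
  induction k with
  | zero => exact hu j
  | succ k ih =>
    exact contDiffOn_const.mul (ContDiffOn.sum fun π _ => contDiffOn_partialDeriv hΩ (ih _) _)

theorem innerDerivPow_scalar (hΩ : IsOpen Ω) {u : Euc n → ℂ} (hu : ContDiffOn ℝ ∞ u Ω) (N : ℕ)
    (j : Fin (0 + N) → Fin n) :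
    EqOn (fun y => innerDerivPow (m := 0) N (fun z _ => u z) y j) (iterDeriv (List.ofFn j) u)
      Ω := by
  induction N with
  | zero => exact fun _ _ => rfl
  | succ N ih =>
    intro y hy
    have hlast (i : Fin (0 + N + 1) → Fin n) : partialDeriv (i (Fin.last (0 + N)))
        (fun z => innerDerivPow (m := 0) N (fun z _ => u z) z (Fin.init i)) y =
          iterDeriv (List.ofFn i) u y := by
      rw [partialDeriv_eqOn hΩ (ih (Fin.init i)) _ hy, ← iterDeriv_cons]
      conv_rhs => rw [← Fin.snoc_init_self i]
      exact iterDeriv_perm hΩ hu (ofFn_snoc_perm _ _).symm hy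
    have hsymm : IsSymm (fun i : Fin (0 + N + 1) → Fin n => iterDeriv (List.ofFn i) u y) :=
      fun π i => iterDeriv_perm hΩ hu (Equiv.Perm.ofFn_comp_perm π i) hy
    exact (congrFun (congrArg symmetrize (funext hlast)) j).trans
      (congrFun (symmetrize_of_isSymm hsymm) j)

theorem partialDeriv_sum_const_mul {ι : Type*} {s : Finset ι} {v : ι → Euc n → ℂ}
    (hv : ∀ i ∈ s, DifferentiableAt ℝ (v i) y) (c : ι → ℂ) (l : Fin n) :
    partialDeriv l (fun z => ∑ i ∈ s, c i * v i z) y = ∑ i ∈ s, c i * partialDeriv l (v i) y :=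
  (partialDeriv_sum (fun i hi => (hv i hi).const_mul (c i)) l).trans
    (Finset.sum_congr rfl fun i hi => partialDeriv_const_mul (hv i hi) (c i) l)

theorem sum_mul_innerDerivPow (hΩ : IsOpen Ω) (hu : ∀ J, ContDiffOn ℝ ∞ (fun z => u z J) Ω)
    (hT : ∀ {R R'}, R.Perm R' → T R = T R') (k : ℕ) :
    EqOn (fun y => ∑ j, T (List.ofFn j) * innerDerivPow k u y j)
      (fun y => ∑ b : (Fin m → Fin n) × (Fin k → Fin n),
        T (List.ofFn b.1 ++ List.ofFn b.2) * iterDeriv (List.ofFn b.2) (fun z => u z b.1) y) Ω := by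
  induction k generalizing T with
  | zero => exact fun y _ => by simp [innerDerivPow, iterDeriv, Fintype.sum_prod_type]
  | succ k ih =>
    intro y hy
    have hdiff (j : Fin (m + k) → Fin n) : DifferentiableAt ℝ (fun z => innerDerivPow k u z j) y :=
      differentiableAt_of_contDiffOn hΩ (contDiffOn_innerDerivPow hΩ hu k j) hy
    have hdiff' (b : (Fin m → Fin n) × (Fin k → Fin n)) :
        DifferentiableAt ℝ (iterDeriv (List.ofFn b.2) fun z => u z b.1) y :=
      differentiableAt_of_contDiffOn hΩ (contDiffOn_iterDeriv hΩ (hu b.1) _) hy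
    have hstep (l : Fin n) :
        ∑ j, T (l :: List.ofFn j) * partialDeriv l (fun z => innerDerivPow k u z j) y =
          ∑ b : (Fin m → Fin n) × (Fin k → Fin n), T (l :: (List.ofFn b.1 ++ List.ofFn b.2)) *
            iterDeriv (l :: List.ofFn b.2) (fun z => u z b.1) y := by
      rw [← partialDeriv_sum_const_mul (fun j _ => hdiff j),
        partialDeriv_eqOn hΩ (ih fun hR => hT (hR.cons l)) l hy,
        partialDeriv_sum_const_mul fun b _ => hdiff' b]
      rfl
    refine (sum_mul_innerDeriv hT (innerDerivPow k u) y).trans ?_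
    simp only [hstep, Fintype.sum_prod_type]
    rw [Finset.sum_comm]
    refine Finset.sum_congr rfl fun J _ => ?_
    rw [← (Fin.consEquiv fun _ : Fin (k + 1) => Fin n).sum_comp, Fintype.sum_prod_type]
    refine Finset.sum_congr rfl fun l _ => Finset.sum_congr rfl fun K _ => ?_
    have hcons : List.ofFn ((Fin.consEquiv fun _ : Fin (k + 1) => Fin n) (l, K)) =
        l :: List.ofFn K := List.ofFn_cons l K
    rw [hcons, hT List.perm_middle]

theorem contractVecPow_eq_iterate_contractPos {r k : ℕ} {S : ListField n}
    (hS : ∀ {R R'}, R.Perm R' → S R y = S R' y) {v : Tensor n (r + k)}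
    (hv : ∀ j, v j = S (List.ofFn j) y) (i : Fin r → Fin n) :
    contractVecPow y k v i = contractPos^[k] S (List.ofFn i) y := by
  induction k generalizing S with
  | zero => exact hv i
  | succ k ih =>
    refine ih (fun hR => Finset.sum_congr rfl fun l _ => by rw [hS (hR.cons l)]) fun j => ?_
    refine Fintype.sum_equiv (Equiv.funUnique (Fin 1) (Fin n)) _ _ fun l => ?_
    have hperm : (List.ofFn (Fin.append j l)).Perm (l 0 :: List.ofFn j) := by
      rw [List.ofFn_fin_append]
      exact List.perm_append_singleton _ _
    rw [mul_comm, hv, ofFn_comp_cast, hS hperm]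
    rfl

theorem tensorA_zero_apply (m : ℕ) (hy : y ≠ 0) (j : Fin (2 * m - 0) → Fin n) :
    tensorA n m 0 y j = iterDeriv (List.ofFn j) (normPow (2 * (m : ℤ) - 1)) y := by
  have h := innerDerivPow_scalar isOpen_compl_singleton
    (contDiffOn_normPow (n := n) (2 * (m : ℤ) - 2 * ((0 : ℕ) : ℤ) - 1)) (2 * m - 0)
    (j ∘ Fin.cast (zero_add _)) hy
  rw [ofFn_comp_cast, Nat.cast_zero, mul_zero, sub_zero] at h
  exact h

theorem contract_tensorA_innerDerivPow {k : ℕ} (hu : ∀ J, ContDiffOn ℝ ∞ (fun z => u z J) {0}ᶜ)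
    (hy : y ≠ 0) (h : (m - k) + (m + k) = 2 * m - 0) (i : Fin (m - k) → Fin n) :
    (normalConst n m : ℂ) * contract h (tensorA n m 0 y) (innerDerivPow k u y) i =
      symbolField (fun J z => u z J) k m (List.ofFn i) y := by
  have hlen : (List.ofFn i).length + (m + k) = 2 * m := by
    rw [List.length_ofFn]
    omega
  have happend (j : Fin (m + k) → Fin n) : tensorA n m 0 y (Fin.append i j ∘ Fin.cast h.symm) =
      iterDeriv (List.ofFn i ++ List.ofFn j) (normPow (2 * (m : ℤ) - 1)) y := by
    rw [tensorA_zero_apply m hy, ofFn_comp_cast, List.ofFn_fin_append]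
  rw [symbolField, if_pos hlen, contract]
  simp only [happend]
  congr 1
  exact sum_mul_innerDerivPow (u := u)
    (T := fun R => iterDeriv (List.ofFn i ++ R) (normPow (2 * (m : ℤ) - 1)) y)
    isOpen_compl_singleton hu (fun hR => iterDeriv_perm isOpen_compl_singleton
      (contDiffOn_normPow _) (hR.append_left _) hy) k hy

theorem tensorF_eq_smul {k : ℕ} (hk : k ≤ m) (G : Euc n → Tensor n m) (y : Euc n) :
    tensorF hk G y = ((normalConst n m : ℂ) * (k.factorial : ℂ))⁻¹ •
      contractVecPow y k (castRank (Nat.sub_add_cancel hk).symm (G y)) := by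
  rw [tensorF, ← div_div, normalConst, Complex.ofReal_div, Complex.ofReal_inv,
    Complex.ofReal_natCast, mul_inv, inv_inv, div_eq_mul_inv]

end SymmetricTensors

section NormalSymbol

variable {k : ℕ}

/-- The Fourier transform of `N_m^k f` off the origin, see `integral_normalSymbol_mul`. -/
def normalSymbol (k : ℕ) (f : (Fin m → Fin n) → 𝓢(Euc n, ℂ)) : ListField n :=
  (-1 : ℂ) ^ k • divergence^[k] (symbolField (fun J => fourier n (f J)) k (m + k))

theorem isSmoothSymmOn_symbolField_fourier (k p : ℕ) (f : (Fin m → Fin n) → 𝓢(Euc n, ℂ)) :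
    (symbolField (fun J => fourier n (f J)) k p).IsSmoothSymmOn {0}ᶜ :=
  isSmoothSymmOn_symbolField (fun J => ((fourier n (f J)).smooth ⊤).contDiffOn) k p

theorem isSmoothSymmOn_normalSymbol (k : ℕ) (f : (Fin m → Fin n) → 𝓢(Euc n, ℂ)) :
    (normalSymbol k f).IsSmoothSymmOn {0}ᶜ :=
  have h := (isSmoothSymmOn_symbolField_fourier k (m + k) f).iterate_divergence
    isOpen_compl_singleton k
  ⟨fun hR _ hy => congrArg ((-1 : ℂ) ^ k * ·) (h.perm hR hy),
    fun R => contDiffOn_const.mul (h.smooth R)⟩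

variable [n.AtLeastTwo]

theorem integral_symbolField_mul (f : (Fin m → Fin n) → 𝓢(Euc n, ℂ)) (i : Fin m → Fin n)
    (K : Fin k → Fin n) {φ : 𝓢(Euc n, ℂ)} (hφ : IsTestOn {0}ᶜ φ) :
    ∫ y, symbolField (fun J => fourier n (f J)) k (m + k) (List.ofFn K ++ List.ofFn i) y *
        iterDeriv (List.ofFn K) φ y =
      ∑ b : (Fin m → Fin n) × (Fin k → Fin n), ∫ x, normalTerm f i (K, b) x * fourier n φ x := by
  have hlen : (List.ofFn K ++ List.ofFn i).length + (m + k) = 2 * (m + k) := by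
    simp only [List.length_append, List.length_ofFn]
    ring
  have hint (b : (Fin m → Fin n) × (Fin k → Fin n)) :
      Integrable (fun y => iterDeriv (normalWord i (K, b)) (normPow (2 * ((m + k : ℕ) : ℤ) - 1)) y *
        (iterDeriv (List.ofFn b.2) (fourier n (f b.1)) y * iterDeriv (List.ofFn K) φ y)) := by
    simp only [← mul_assoc]
    exact (hφ.iterDeriv _).integrable_mul isOpen_compl_singleton
      ((contDiffOn_iterDeriv isOpen_compl_singleton (contDiffOn_normPow _) _).mul
        (contDiffOn_iterDeriv isOpen_compl_singleton
          ((fourier n (f b.1)).smooth ⊤).contDiffOn _)).continuousOn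
  simp only [integral_normalTerm_mul_fourier f i _ hφ]
  rw [← Finset.mul_sum, ← integral_finsetSum _ fun b _ => hint b, ← integral_const_mul]
  simp only [symbolField, if_pos hlen, normalWord, mul_assoc, Finset.sum_mul]

theorem integral_normalSymbol_mul (f : (Fin m → Fin n) → 𝓢(Euc n, ℂ)) (i : Fin m → Fin n)
    {φ : 𝓢(Euc n, ℂ)} (hφ : IsTestOn {0}ᶜ φ) :
    ∫ y, normalSymbol k f (List.ofFn i) y * φ y = ∫ x, normalOp k f x i * fourier n φ x := by
  have hsign : (-1 : ℂ) ^ k * (-1) ^ k = 1 := by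
    rw [← mul_pow, neg_one_mul, neg_neg, one_pow]
  simp only [normalSymbol, Pi.smul_apply, smul_eq_mul, mul_assoc, normalOp_eq_sum, Finset.sum_mul]
  rw [integral_const_mul, integral_iterate_divergence_mul isOpen_compl_singleton
      (isSmoothSymmOn_symbolField_fourier k (m + k) f) hφ, ← mul_assoc, hsign, one_mul,
    integral_finsetSum _ fun a _ => integrable_normalTerm_mul f i a _, Fintype.sum_prod_type]
  exact Finset.sum_congr rfl fun K _ => integral_symbolField_mul f i K hφ

theorem iterate_contractPos_normalSymbol (f : (Fin m → Fin n) → 𝓢(Euc n, ℂ)) (X : List (Fin n))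
    {y : Euc n} (hy : y ≠ 0) :
    contractPos^[k] (normalSymbol k f) X y =
      (k.factorial : ℂ) * symbolField (fun J => fourier n (f J)) k m X y := by
  have hsign : (-1 : ℂ) ^ k * (-1) ^ k = 1 := by
    rw [← mul_pow, neg_one_mul, neg_neg, one_pow]
  rw [normalSymbol, iterate_contractPos_smul, Pi.smul_apply, Pi.smul_apply, smul_eq_mul,
    iterate_contractPos_iterate_divergence (isSmoothSymmOn_symbolField_fourier k (m + k) f)
      isOpen_compl_singleton (fun X _ hz => contractPos_symbolField _ k (m + k) X hz) k X hy,
    iterate_trace_symbolField _ k m k X hy, ← mul_assoc, ← mul_assoc, hsign, one_mul]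

theorem contract_tensorA_innerDerivPow_eq_tensorF (hk : k ≤ m)
    (h : (m - k) + (m + k) = 2 * m - 0) (f : (Fin m → Fin n) → 𝓢(Euc n, ℂ)) {y : Euc n}
    (hy : y ≠ 0) :
    contract h (tensorA n m 0 y) (innerDerivPow k (fun z i => fourier n (f i) z) y) =
      tensorF hk (fun y i => normalSymbol k f (List.ofFn i) y) y := by
  funext i
  have hconst : (normalConst n m : ℂ) ≠ 0 := Complex.ofReal_ne_zero.2 (normalConst_ne_zero m)
  have hfact : (k.factorial : ℂ) ≠ 0 := Nat.cast_ne_zero.2 k.factorial_ne_zero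
  have hcontract : contractVecPow y k (castRank (Nat.sub_add_cancel hk).symm
      fun i => normalSymbol k f (List.ofFn i) y) i =
        (k.factorial : ℂ) * symbolField (fun J => fourier n (f J)) k m (List.ofFn i) y := by
    rw [← iterate_contractPos_normalSymbol f _ hy]
    exact contractVecPow_eq_iterate_contractPos
      (fun hR => (isSmoothSymmOn_normalSymbol k f).perm hR hy)
      (fun j => by rw [castRank, ofFn_comp_cast]) i
  rw [tensorF_eq_smul, Pi.smul_apply, hcontract, smul_eq_mul, eq_inv_mul_iff_mul_eq₀
    (mul_ne_zero hconst hfact), mul_right_comm, contract_tensorA_innerDerivPow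
    (fun J => ((fourier n (f J)).smooth ⊤).contDiffOn) hy, mul_comm]

end NormalSymbol

/-- `2 * m - 0` is the rank of `A^{(m,0)}`. -/
theorem rank_sub_add_rank_add {k : ℕ} (hk : k ≤ m) : (m - k) + (m + k) = 2 * m - 0 := by
  omega

end MomentumRay

end

open MomentumRay in
theorem proposition4p4_general (n m k : ℕ) (hn : 2 ≤ n) (hk : k ≤ m)
    (f : (Fin m → Fin n) → 𝓢(Euc n, ℂ)) :
    ∃ (U : (Fin m → Fin n) → 𝓢'(Euc n, ℂ)) (G : Euc n → Tensor n m),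
      (∀ i, IsDefinedBy (U i) (fun x => normalOp k f x i)) ∧
      (∀ i, RestrictsOffOriginTo (fourierDistribution (U i)) (fun y => G y i)) ∧
      ContDiffOn ℝ ∞ G {0}ᶜ ∧
      (∀ y : Euc n, y ≠ 0 → IsSymm (G y)) ∧
      ∀ y : Euc n, y ≠ 0 →
        contract (rank_sub_add_rank_add hk) (tensorA n m 0 y)
          (innerDerivPow k (fun z i => fourier n (f i) z) y) = tensorF hk G y := by
  have : n.AtLeastTwo := ⟨hn⟩
  choose U hU using exists_isDefinedBy_normalOp k f
  have hS := isSmoothSymmOn_normalSymbol k f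
  refine ⟨U, fun y i => normalSymbol k f (List.ofFn i) y, hU, fun i φ hcompact hsupp => ?_,
    contDiffOn_pi.2 fun i => hS.smooth _,
    fun y hy π i => hS.perm (Equiv.Perm.ofFn_comp_perm π i) hy,
    fun y hy => contract_tensorA_innerDerivPow_eq_tensorF hk _ f hy⟩
  have hφ : IsTestOn {0}ᶜ φ := ⟨φ.smooth ⊤, hcompact, hsupp⟩
  refine ⟨hφ.integrable_mul isOpen_compl_singleton (hS.smooth _).continuousOn, ?_⟩
  exact (hU i (fourier n φ)).2.trans (integral_normalSymbol_mul f i hφ).symm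

open MomentumRay in
/-- For a Schwartz symmetric tensor field `f` of rank `m`, the field `N_m^k f` defines a tempered
tensor distribution `U`, whose Fourier transform is on `ℝⁿ ∖ {0}` a smooth symmetric tensor field
`G`, and `A^{(m,0)} / (d^k f̂) = F^{(m,k)}` on `ℝⁿ ∖ {0}`. -/
theorem proposition4p4 (n m k : ℕ) (hn : 2 ≤ n) (hk : k ≤ m)
    (f : (Fin m → Fin n) → 𝓢(Euc n, ℂ)) (hf : IsSymm f) :
    ∃ (U : (Fin m → Fin n) → 𝓢'(Euc n, ℂ)) (G : Euc n → Tensor n m),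
      (∀ i, IsDefinedBy (U i) (fun x => normalOp k f x i)) ∧
      (∀ i, RestrictsOffOriginTo (fourierDistribution (U i)) (fun y => G y i)) ∧
      ContDiffOn ℝ ∞ G {0}ᶜ ∧
      (∀ y : Euc n, y ≠ 0 → IsSymm (G y)) ∧
      ∀ y : Euc n, y ≠ 0 →
        contract (show (m - k) + (m + k) = 2 * m - 0 by omega) (tensorA n m 0 y)
          (innerDerivPow k (fun z i => fourier n (f i) z) y) = tensorF hk G y :=
  proposition4p4_general n m k hn hk f
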